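/- Let $M$ be a smooth ($C^\infty$, Hausdorff, second countable) manifold of dimension $n$, with a measure $dz$ that has a smooth positive density in every smooth chart (e.g. a Riemannian volume). *Foliations.* A Hölder foliation chart with smooth leaves is a locally bi-Hölder homeomorphism $\Gamma$ of an open set $O\subset\mathbb R^{n_1}_x\times\mathbb R^{n_2}_y$ ($n_1+n_2=n$) onto an open subset of $M$ such that $\Gamma$ has $y$-derivatives of all orders, these are locally Hölder in $(x,y)$, and every $\Gamma(x,\cdot)$ is an immersion. A Hölder foliation $\mathcal F$ with smooth leaves is given by a family of such charts that covers $M$ and whose coordinate changes locally map plaques $\{x\}\times\mathbb R^{n_2}$ into plaques. Its tangent space at $z=\Gamma(x,y)$ is the image of $d_y\Gamma(x,\cdot)$. It is strongly absolutely continuous if for each chart $\Gamma:O\to M$ there is a continuous function $J>0$ on $O$, with $y$-derivatives of all orders that are locally Hölder in $(x,y)$, such that $\int f(z)\,dz=\int_O f(\Gamma(x,y))J(x,y)\,dx\,dy$ for every continuous $f$ with compact support in $\Gamma(O)$. The Hölder exponents may depend on the chart, the place, and the order of the derivative. *Derivatives along $\mathcal F$.* In a chart $\Gamma$ let $V_1,\dots,V_{n_2}$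 be the push-forwards of $\partial/\partial y_1,\dots,\partial/\partial y_{n_2}$. For $0<\alpha\le 1$ let $C^\alpha$ be the space of real $\alpha$-Hölder functions with compact support in $U$, where $U$ is the intersection of $\Gamma(O)$ with the domain of a smooth chart of $M$ (in which Hölder norms are measured), and let $C^{\alpha,k}_{\mathcal F}\subset C^\alpha$ be the space of those $h$ for which all derivatives $V_{j_1}\cdots V_{j_l}h$, $l\le k$, exist along the leaves and are in $C^\alpha$. The derivatives of a distribution are defined by $\langle V_jD,h\rangle=-\langle D,V_jh\rangle$, so that for a distribution $D$ given by integration against an $L^1$ function, $V_{j_1}\cdots V_{j_k}D$ is a functional on $C^{\alpha,k}_{\mathcal F}$. It is said to belong to $(C^\alpha)^*$ if it extends to a linear functional on $C^\alpha$ which, for each compact $K\subset U$, is bounded with respect to the $\alpha$-Hölder norm on the functions supported in $K$. **Statement.** Let $\mathcal F_1,\dots,\mathcal F_r$ be Hölder foliations with smooth leaves on $M$ which are strongly absolutely continuous, and assume that the tangent spaces of these foliations at $z$ together span $T_zM$ for every $z\in M$. Let $u$ be a real or complex valued $L^1$ function on $M$ and let $D$ be the distribution $D(h)=\int h\,u\,dz$.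 Assume that for every $i=1,\dots,r$ and every $0<\alpha\le 1$ each derivative of $D$ of any order along $\mathcal F_i$ (in all foliation charts of $\mathcal F_i$ and smooth charts of $M$) belongs to $(C^\alpha)^*$. Then $u$ is $C^\infty$, i.e. it agrees almost everywhere with a $C^\infty$ function on $M$. -/

import Mathlib

open scoped Manifold ContDiff Topology NNReal
open MeasureTheory Set

/-- The Euclidean space `ℝᵈ`. -/
abbrev Euc (d : ℕ) : Type := EuclideanSpace ℝ (Fin d)

namespace LeafRegularity

/-- `f` is locally Hölder on `s`: near every point of `s` it is Hölder for some exponent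
in `(0, 1]`. -/
def LocallyHolderOn {X Y : Type*} [PseudoEMetricSpace X] [PseudoEMetricSpace Y]
    (f : X → Y) (s : Set X) : Prop :=
  ∀ z ∈ s, ∃ t ∈ 𝓝[s] z, ∃ C α : ℝ≥0, 0 < α ∧ α ≤ 1 ∧ HolderOnWith C α f t

/-- On the set `s ⊆ ℝᵖ × ℝ^q`, with coordinates `(x, y)`, the map `g` has `y`-derivatives of all
orders, and each of them (order `0` included) is locally Hölder in `(x, y)`. -/
def SmoothHolderAlongY {p q : ℕ} {G : Type*} [NormedAddCommGroup G] [NormedSpace ℝ G]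
    (g : Euc p × Euc q → G) (s : Set (Euc p × Euc q)) : Prop :=
  (∀ w ∈ s, ContDiffAt ℝ ∞ (fun y => g (w.1, y)) w.2) ∧
    ∀ k : ℕ, LocallyHolderOn (fun w => iteratedFDeriv ℝ k (fun y => g (w.1, y)) w.2) s

section Manifold

variable {n : ℕ} {M : Type*} [TopologicalSpace M]

variable {𝕜 : Type*} [RCLike 𝕜]

/-- The derivative of `h` along the vector field `V_j`, the push-forward under `Γ` of the constant
field `∂/∂y_j`. It is extended by zero outside the image of `Γ`. -/
noncomputable def leafDeriv {p q : ℕ} (Γ : OpenPartialHomeomorph (Euc p × Euc q) M) (j : Fin q)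
    (h : M → ℝ) : M → ℝ :=
  Γ.target.indicator fun z =>
    fderiv ℝ (fun y => h (Γ ((Γ.symm z).1, y))) (Γ.symm z).2 (EuclideanSpace.single j 1)

/-- `V_{j₁} (V_{j₂} (⋯ (V_{jₖ} h)))` for the sequence `js = [j₁, …, jₖ]`. -/
noncomputable def leafDerivs {p q : ℕ} (Γ : OpenPartialHomeomorph (Euc p × Euc q) M)
    (js : List (Fin q)) (h : M → ℝ) : M → ℝ :=
  js.foldr (leafDeriv Γ) h

/-- The `α`-Hölder norm of `h`, read in the chart `φ`, is at most `B`: both the supremum of `|h|`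
and the best `α`-Hölder constant are at most `B`. -/
def HolderNormLE (φ : OpenPartialHomeomorph M (Euc n)) (α B : ℝ≥0) (h : M → ℝ) : Prop :=
  (∀ z, |h z| ≤ B) ∧ HolderOnWith B α (fun z => h (φ.symm z)) φ.target

/-- The space `C^α` of `α`-Hölder functions with compact support in the open set `U`, where
`U` lies in the domain of the chart `φ`. -/
def holderSpace (φ : OpenPartialHomeomorph M (Euc n)) (U : Set M) (α : ℝ≥0) :
    Submodule ℝ (M → ℝ) where
  carrier := {h | HasCompactSupport h ∧ tsupport h ⊆ U ∧ ∃ B, HolderNormLE φ α B h}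
  zero_mem' := by
    refine ⟨HasCompactSupport.zero, by simp, 0, by simp, ?_⟩
    intro x _ y _
    simp
  add_mem' := by
    rintro f g ⟨hf, hfU, B, hB, hB'⟩ ⟨hg, hgU, C, hC, hC'⟩
    refine ⟨hf.add hg, (tsupport_add f g).trans (union_subset hfU hgU), B + C, ?_, ?_⟩
    · intro z
      simpa using (abs_add_le (f z) (g z)).trans (add_le_add (hB z) (hC z))
    · intro x hx y hy
      have h1 := hB' x hx y hy
      have h2 := hC' x hx y hy
      calc edist ((f + g) (φ.symm x)) ((f + g) (φ.symm y))
          ≤ edist (f (φ.symm x)) (f (φ.symm y)) + edist (g (φ.symm x)) (g (φ.symm y)) :=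
            edist_add_add_le _ _ _ _
        _ ≤ _ := by
            refine (add_le_add h1 h2).trans (le_of_eq ?_)
            push_cast
            ring
  smul_mem' := by
    rintro c f ⟨hf, hfU, B, hB, hB'⟩
    refine ⟨hf.smul_left (f := fun _ => c), (tsupport_smul_subset_right (fun _ => c) f).trans hfU,
      ‖c‖₊ * B, ?_, ?_⟩
    · intro z
      simpa [abs_mul] using mul_le_mul_of_nonneg_left (hB z) (abs_nonneg c)
    · intro x hx y hy
      have h1 := hB' x hx y hy
      calc edist ((c • f) (φ.symm x)) ((c • f) (φ.symm y))
          ≤ ‖c‖₊ * edist (f (φ.symm x)) (f (φ.symm y)) := by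
            simpa [ENNReal.smul_def] using (edist_smul_le c (f (φ.symm x)) (f (φ.symm y)))
        _ ≤ _ := by
            rw [ENNReal.coe_mul, mul_assoc]
            gcongr

/-- The space `C^{α,k}_F`: functions in `C^α` which have derivatives of all orders `≤ k` along the
foliation, all of them again `α`-Hölder. -/
def leafHolderSpace {p q : ℕ} (Γ : OpenPartialHomeomorph (Euc p × Euc q) M)
    (φ : OpenPartialHomeomorph M (Euc n)) (α : ℝ≥0) (k : ℕ) : Set (M → ℝ) :=
  {h | (∀ js : List (Fin q), js.length ≤ k →
        leafDerivs Γ js h ∈ holderSpace φ (Γ.target ∩ φ.source) α) ∧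
      ∀ js : List (Fin q), js.length < k → ∀ w ∈ Γ.source,
        DifferentiableAt ℝ (fun y => leafDerivs Γ js h (Γ (w.1, y))) w.2}

/-- The derivative `V_j D` of a distribution: `⟨V_j D, h⟩ = -⟨D, V_j h⟩`. -/
noncomputable def distDeriv {p q : ℕ} (Γ : OpenPartialHomeomorph (Euc p × Euc q) M) (j : Fin q)
    (D : (M → ℝ) → 𝕜) : (M → ℝ) → 𝕜 :=
  fun h => -D (leafDeriv Γ j h)

/-- `V_{j₁} (V_{j₂} (⋯ (V_{jₖ} D)))` for the sequence `js = [j₁, …, jₖ]`. -/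
noncomputable def distDerivs {p q : ℕ} (Γ : OpenPartialHomeomorph (Euc p × Euc q) M)
    (js : List (Fin q)) (D : (M → ℝ) → 𝕜) : (M → ℝ) → 𝕜 :=
  js.foldr (distDeriv Γ) D

/-- The functional `D`, given on `C^{α,k}_F`, belongs to the dual of `C^α`: it extends to a linear
functional on `C^α` that is continuous for the `α`-Hölder norm on the functions supported in
any given compact set. -/
def ExtendsToHolderDual {p q : ℕ} (Γ : OpenPartialHomeomorph (Euc p × Euc q) M)
    (φ : OpenPartialHomeomorph M (Euc n)) (α : ℝ≥0) (k : ℕ) (D : (M → ℝ) → 𝕜) : Prop :=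
  ∃ T : holderSpace φ (Γ.target ∩ φ.source) α →ₗ[ℝ] 𝕜,
    (∀ K : Set M, IsCompact K → K ⊆ Γ.target ∩ φ.source →
      ∃ C : ℝ, ∀ h : holderSpace φ (Γ.target ∩ φ.source) α, tsupport (h : M → ℝ) ⊆ K →
        ∀ B : ℝ≥0, HolderNormLE φ α B h → ‖T h‖ ≤ C * B) ∧
    ∀ h : holderSpace φ (Γ.target ∩ φ.source) α, (h : M → ℝ) ∈ leafHolderSpace Γ φ α k →
      T h = D h

variable [ChartedSpace (Euc n) M]

variable (n) in
/-- `Γ`, a homeomorphism of an open subset of `ℝᵖ × ℝ^q` onto an open subset of `M`, is a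
Hölder foliation chart with smooth leaves. All conditions are read in the smooth charts `φ`
of `M`. -/
structure IsHolderFoliationChart {p q : ℕ}
    (Γ : OpenPartialHomeomorph (Euc p × Euc q) M) : Prop where
  /-- `Γ` is Hölder, with Hölder `y`-derivatives of all orders. -/
  smoothHolder : ∀ φ ∈ atlas (Euc n) M,
    SmoothHolderAlongY (fun w => φ (Γ w)) (Γ.source ∩ Γ ⁻¹' φ.source)
  /-- `Γ⁻¹` is Hölder. -/
  holder_symm : ∀ φ ∈ atlas (Euc n) M,
    LocallyHolderOn (fun z => Γ.symm (φ.symm z)) (φ.target ∩ φ.symm ⁻¹' Γ.target)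
  /-- For fixed `x` the map `Γ (x, ·)` is an immersion. -/
  immersion : ∀ φ ∈ atlas (Euc n) M, ∀ w ∈ Γ.source ∩ Γ ⁻¹' φ.source,
    Function.Injective (fderiv ℝ (fun y => φ (Γ (w.1, y))) w.2)

variable (n M) in
/-- A Hölder foliation with smooth leaves on the `n`-manifold `M`, given by a foliated atlas:
a covering family of Hölder foliation charts whose changes of coordinates locally map plaques
`{x} × ℝ^dim` into plaques. -/
structure HolderFoliation where
  /-- the dimension of the transversals, the `x`-coordinates -/
  codim : ℕ
  /-- the dimension of the leaves, the `y`-coordinates -/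
  dim : ℕ
  codim_add_dim : codim + dim = n
  charts : Set (OpenPartialHomeomorph (Euc codim × Euc dim) M)
  isChart : ∀ Γ ∈ charts, IsHolderFoliationChart n Γ
  cover : ∀ z : M, ∃ Γ ∈ charts, z ∈ Γ.target
  compatible : ∀ Γ ∈ charts, ∀ Γ' ∈ charts, ∀ w ∈ Γ.source, Γ w ∈ Γ'.target →
    ∃ W ∈ 𝓝 w, ∀ a ∈ W, ∀ b ∈ W, a.1 = b.1 → (Γ'.symm (Γ a)).1 = (Γ'.symm (Γ b)).1

/-- The tangent space at `z` to the leaf through `z`: the image of the differential at `y` of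
`Γ (x, ·)`, where `z = Γ (x, y)`. (It does not depend on the foliation chart `Γ` around `z`; the
supremum only avoids a choice of `Γ`.) -/
noncomputable def HolderFoliation.tangentSpace (F : HolderFoliation n M) (z : M) :
    Submodule ℝ (TangentSpace 𝓘(ℝ, Euc n) z) :=
  ⨆ Γ ∈ F.charts, ⨆ _ : z ∈ Γ.target,
    LinearMap.range (mfderiv 𝓘(ℝ, Euc F.dim) 𝓘(ℝ, Euc n)
      (fun y : Euc F.dim => Γ ((Γ.symm z).1, y)) (Γ.symm z).2).toLinearMap

/-- `μ` has a smooth positive density with respect to Lebesgue measure in every smooth chart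
(for example, the volume of a smooth Riemannian metric). -/
def IsSmoothVolume [MeasurableSpace M] (μ : Measure M) : Prop :=
  ∀ φ ∈ atlas (Euc n) M, ∃ ρ : Euc n → ℝ, ContDiffOn ℝ ∞ ρ φ.target ∧
    (∀ z ∈ φ.target, 0 < ρ z) ∧
    (μ.restrict φ.source).map φ =
      (volume.restrict φ.target).withDensity (fun z => ENNReal.ofReal (ρ z))

/-- Strong absolute continuity: in each foliation chart, `μ` is `J(x, y) dx dy` for a positive
continuous function `J` whose `y`-derivatives of all orders exist and are Hölder in `(x, y)`. -/
def HolderFoliation.StronglyAbsolutelyContinuous (F : HolderFoliation n M)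
    [MeasurableSpace M] (μ : Measure M) : Prop :=
  ∀ Γ ∈ F.charts, ∃ J : Euc F.codim × Euc F.dim → ℝ,
    ContinuousOn J Γ.source ∧ (∀ w ∈ Γ.source, 0 < J w) ∧ SmoothHolderAlongY J Γ.source ∧
    ∀ f : M → ℝ, Continuous f → HasCompactSupport f → tsupport f ⊆ Γ.target →
      ∫ z, f z ∂μ = ∫ w in Γ.source, f (Γ w) * J w

/-- All derivatives of the distribution `D` of every order along the foliation `F` belong to the
dual of the space of `α`-Hölder functions, for all `α`. -/
def HolderFoliation.DerivsDualToHolder (F : HolderFoliation n M) (D : (M → ℝ) → 𝕜) : Prop :=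
  ∀ Γ ∈ F.charts, ∀ φ ∈ atlas (Euc n) M, ∀ js : List (Fin F.dim), ∀ α : ℝ≥0, 0 < α → α ≤ 1 →
    ExtendsToHolderDual Γ φ α js.length (distDerivs Γ js D)

end Manifold

end LeafRegularity

/-! The Fourier transform of a localization of `u` in a chart `φ` decays rapidly, by nonstationary
phase along the leaves. Let `ξ₀` be a nonzero covector at `z₀`. Since the leaf directions span, some
field `V_j` of some foliation has `⟨ξ₀, dφ V_j⟩ ≠ 0` at `z₀`. For `ξ` near `ξ₀` and `z` near `z₀`
the phase `ψ = ⟨ξ, φ⟩` then satisfies `|V_j ψ| ≥ c > 0`, and with `a = b / V_j ψ` `b cos(lψ + θ) =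
l⁻¹ (V_j (a sin(lψ + θ)) - (V_j a) sin(lψ + θ))`. Iterating `N` times gains `l⁻ᴺ` and lets `V_j^m
D`, `m ≤ N`, act on a fixed amplitude times a cosine. These functionals are bounded by the
`α`-Hölder norm alone, which is only `O(l)` here, however large `m` is. So the localized integrals
are `O(l^(1 - N))` (`exists_decay`).

Compactness of the unit sphere makes the decay uniform in the direction
(`eventually_decaysOn_sphere`), and Fourier inversion gives a `C^k` version of `u` near `z₀`
(`exists_contDiff_ae_eq`, `DecaysOn.exists_contMDiffOn`). The Hölder exponent and the ball depend on
`k`. This is harmless: continuous versions agree on overlaps, so a single function is `C^k` near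
every point for every `k` (`exists_contMDiff_ae_eq`). -/

namespace LeafRegularity

/-! ### Hölder bounds on a set, measured through a chart. -/

section HolderBound

variable {n : ℕ} {M : Type*} {ι : Type*}

/-- `f` is bounded by `C` and `α`-Hölder with constant `C` on `S`, where distances are measured
through `φ`. -/
def HolderBound (φ : M → Euc n) (S : Set M) (α C : ℝ) (f : M → ℝ) : Prop :=
  (∀ z ∈ S, |f z| ≤ C) ∧ ∀ z ∈ S, ∀ z' ∈ S, |f z - f z'| ≤ C * dist (φ z) (φ z') ^ α

variable {φ : M → Euc n} {S : Set M} {α : ℝ}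

theorem le_rpow_of_le_one {d a : ℝ} (h0 : 0 ≤ d) (h1 : d ≤ 1) (ha : a ≤ 1) : d ≤ d ^ a := by
  rcases h0.eq_or_lt with h | h
  · rw [← h]; exact Real.rpow_nonneg le_rfl _
  · simpa using Real.rpow_le_rpow_of_exponent_ge h h1 ha

theorem HolderBound.congr {C : ℝ} {f g : M → ℝ} (hf : HolderBound φ S α C f) (h : EqOn g f S) :
    HolderBound φ S α C g :=
  ⟨fun z hz => by rw [h hz]; exact hf.1 z hz,
    fun z hz z' hz' => by rw [h hz, h hz']; exact hf.2 z hz z' hz'⟩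

theorem HolderBound.mono {C C' : ℝ} {f : M → ℝ} (hf : HolderBound φ S α C f) (h : C ≤ C') :
    HolderBound φ S α C' f :=
  ⟨fun z hz => (hf.1 z hz).trans h, fun z hz z' hz' => (hf.2 z hz z' hz').trans
    (mul_le_mul_of_nonneg_right h (Real.rpow_nonneg dist_nonneg _))⟩

theorem HolderBound.add {C C' : ℝ} {f g : M → ℝ} (hf : HolderBound φ S α C f)
    (hg : HolderBound φ S α C' g) : HolderBound φ S α (C + C') fun z => f z + g z := by
  refine ⟨fun z hz => (abs_add_le _ _).trans (add_le_add (hf.1 z hz) (hg.1 z hz)),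
    fun z hz z' hz' => ?_⟩
  have h : f z + g z - (f z' + g z') = (f z - f z') + (g z - g z') := by ring
  rw [h, add_mul]
  exact (abs_add_le _ _).trans (add_le_add (hf.2 z hz z' hz') (hg.2 z hz z' hz'))

theorem HolderBound.mul {C C' : ℝ} (hC : 0 ≤ C) (hC' : 0 ≤ C') {f g : M → ℝ}
    (hf : HolderBound φ S α C f) (hg : HolderBound φ S α C' g) :
    HolderBound φ S α (2 * C * C') fun z => f z * g z := by
  refine ⟨fun z hz => ?_, fun z hz z' hz' => ?_⟩
  · rw [abs_mul]
    have := mul_le_mul (hf.1 z hz) (hg.1 z hz) (abs_nonneg _) hC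
    nlinarith [mul_nonneg hC hC']
  · have h : f z * g z - f z' * g z' = (f z - f z') * g z + f z' * (g z - g z') := by ring
    have hd : 0 ≤ dist (φ z) (φ z') ^ α := Real.rpow_nonneg dist_nonneg _
    calc _ ≤ |f z - f z'| * |g z| + |f z'| * |g z - g z'| := by
          rw [h, ← abs_mul, ← abs_mul]; exact abs_add_le _ _
      _ ≤ (C * dist (φ z) (φ z') ^ α) * C' + C * (C' * dist (φ z) (φ z') ^ α) :=
          add_le_add
            (mul_le_mul (hf.2 z hz z' hz') (hg.1 z hz) (abs_nonneg _) (mul_nonneg hC hd))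
            (mul_le_mul (hf.1 z' hz') (hg.2 z hz z' hz') (abs_nonneg _) hC)
      _ = _ := by ring

theorem HolderBound.const (c : ℝ) : HolderBound φ S α |c| fun _ => c :=
  ⟨fun _ _ => le_rfl, fun z _ z' _ => by
    simpa using mul_nonneg (abs_nonneg c) (Real.rpow_nonneg dist_nonneg α)⟩

theorem HolderBound.inv {C c : ℝ} (hc : 0 < c) {f : M → ℝ} (hf : HolderBound φ S α C f)
    (hfc : ∀ z ∈ S, c ≤ |f z|) : HolderBound φ S α (max c⁻¹ (C / c ^ 2)) fun z => (f z)⁻¹ := by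
  refine ⟨fun z hz => ?_, fun z hz z' hz' => ?_⟩
  · rw [abs_inv]
    exact (inv_anti₀ hc (hfc z hz)).trans (le_max_left _ _)
  · have h1 := hfc z hz
    have h2 := hfc z' hz'
    have n1 : f z ≠ 0 := abs_pos.1 (hc.trans_le h1)
    have n2 : f z' ≠ 0 := abs_pos.1 (hc.trans_le h2)
    have hd : 0 ≤ dist (φ z) (φ z') ^ α := Real.rpow_nonneg dist_nonneg _
    calc _ = |f z - f z'| / (|f z| * |f z'|) := by
          rw [inv_sub_inv n1 n2, abs_div, abs_mul, abs_sub_comm]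
      _ ≤ (C * dist (φ z) (φ z') ^ α) / (c * c) := by
          gcongr
          · exact (abs_nonneg _).trans (hf.2 z hz z' hz')
          · exact hf.2 z hz z' hz'
      _ = C / c ^ 2 * dist (φ z) (φ z') ^ α := by ring
      _ ≤ _ := mul_le_mul_of_nonneg_right (le_max_right _ _) hd

theorem exists_nonneg_holderBound {f : ι → M → ℝ} (h : ∃ C, ∀ i, HolderBound φ S α C (f i)) :
    ∃ C, 0 ≤ C ∧ ∀ i, HolderBound φ S α C (f i) :=
  let ⟨C, hC⟩ := h
  ⟨max C 0, le_max_right _ _, fun i => (hC i).mono (le_max_left _ _)⟩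

/-- A smooth function is Lipschitz on a closed ball; as `ε ≤ 1 / 2`, distances there are at most
`1`, and Lipschitz implies `α`-Hölder. -/
theorem HolderBound.exists_smooth_comp {x₀ : Euc n} {ε : ℝ} (hε : ε ≤ 1 / 2) (hα : α ≤ 1)
    (hφS : ∀ z ∈ S, φ z ∈ Metric.ball x₀ ε) {β : Euc n → ℝ} (hβ : ContDiff ℝ ∞ β) :
    ∃ C, HolderBound φ S α C fun z => β (φ z) := by
  obtain ⟨C₁, h₁⟩ := (isCompact_closedBall x₀ ε).exists_bound_of_continuousOn
    hβ.continuous.continuousOn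
  obtain ⟨C₂, h₂⟩ := (isCompact_closedBall x₀ ε).exists_bound_of_continuousOn
    (hβ.continuous_fderiv (by simp)).continuousOn
  refine ⟨max C₁ C₂, fun z hz => ?_, fun z hz z' hz' => ?_⟩
  · exact (h₁ _ (Metric.ball_subset_closedBall (hφS z hz))).trans (le_max_left _ _)
  · have hz1 := hφS z hz
    have hz2 := hφS z' hz'
    have hC₂ : 0 ≤ C₂ := (norm_nonneg _).trans (h₂ _ (Metric.ball_subset_closedBall hz1))
    have hd : dist (φ z) (φ z') ≤ 1 := by
      have := dist_triangle_right (φ z) (φ z') x₀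
      rw [Metric.mem_ball] at hz1 hz2
      linarith
    calc |β (φ z) - β (φ z')| ≤ C₂ * dist (φ z) (φ z') := by
          rw [dist_eq_norm]
          exact (convex_closedBall x₀ ε).norm_image_sub_le_of_norm_fderiv_le (𝕜 := ℝ)
            (fun x _ => hβ.differentiable (by simp) x) h₂
            (Metric.ball_subset_closedBall hz2) (Metric.ball_subset_closedBall hz1)
      _ ≤ max C₁ C₂ * dist (φ z) (φ z') ^ α :=
          mul_le_mul (le_max_right _ _) (le_rpow_of_le_one dist_nonneg hd hα) dist_nonneg
            (hC₂.trans (le_max_right _ _))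

/-- The cosine is `1`-Lipschitz, so oscillation costs one factor `l`, whatever `α` is. No other
quantitative estimate of the oscillating factor enters the decay argument. -/
theorem HolderBound.cos {l θ : ℝ} (hl : 1 ≤ l) {ψ : M → ℝ}
    (hψ : ∀ z ∈ S, ∀ z' ∈ S, |ψ z - ψ z'| ≤ dist (φ z) (φ z') ^ α) :
    HolderBound φ S α l fun z => Real.cos (l * ψ z + θ) := by
  refine ⟨fun z _ => (Real.abs_cos_le_one _).trans hl, fun z hz z' hz' => ?_⟩
  have h : LipschitzWith 1 Real.cos := by
    refine lipschitzWith_of_nnnorm_deriv_le Real.differentiable_cos fun x => ?_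
    rw [Real.deriv_cos, ← NNReal.coe_le_coe]
    simpa using Real.abs_sin_le_one x
  have h1 := h.dist_le_mul (l * ψ z + θ) (l * ψ z' + θ)
  rw [Real.dist_eq, Real.dist_eq, NNReal.coe_one, one_mul,
    show l * ψ z + θ - (l * ψ z' + θ) = l * (ψ z - ψ z') by ring, abs_mul,
    abs_of_nonneg (zero_le_one.trans hl)] at h1
  exact h1.trans (mul_le_mul_of_nonneg_left (hψ z hz z' hz') (zero_le_one.trans hl))

end HolderBound

/-! ### Calculus of leafwise smooth functions. -/

section LeafClass

variable {n p q : ℕ} {M : Type*} [TopologicalSpace M] {ι κ : Type*}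

/-- The parametrization by `y` of the plaque of `Γ` through `z`. -/
noncomputable def plaque (Γ : OpenPartialHomeomorph (Euc p × Euc q) M) (z : M) (y : Euc q) : M :=
  Γ ((Γ.symm z).1, y)

/-- `f` is differentiable along the plaques of `Γ` at every point of `S`. -/
def LeafDifferentiableOn {G : Type*} [NormedAddCommGroup G] [NormedSpace ℝ G]
    (Γ : OpenPartialHomeomorph (Euc p × Euc q) M) (S : Set M) (f : M → G) : Prop :=
  ∀ z ∈ S, DifferentiableAt ℝ (fun y => f (plaque Γ z y)) (Γ.symm z).2

/-- The family `f` has leafwise derivatives of all orders `≤ k` on `S`, which are bounded and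
`α`-Hölder uniformly over the family. -/
def LeafClass (Γ : OpenPartialHomeomorph (Euc p × Euc q) M) (φ : M → Euc n) (S : Set M) (α : ℝ) :
    ℕ → (ι → M → ℝ) → Prop
  | 0, f => ∃ C, ∀ i, HolderBound φ S α C (f i)
  | k + 1, f => (∃ C, ∀ i, HolderBound φ S α C (f i)) ∧
      (∀ i, LeafDifferentiableOn Γ S (f i)) ∧
      ∀ j, LeafClass Γ φ S α k (fun i => leafDeriv Γ j (f i))

variable {Γ : OpenPartialHomeomorph (Euc p × Euc q) M} {φ : M → Euc n} {S : Set M} {α : ℝ}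

theorem plaque_self {z : M} (hz : z ∈ Γ.target) : plaque Γ z (Γ.symm z).2 = z := by
  simp [plaque, Γ.right_inv hz]

theorem continuousAt_plaque {z : M} (hz : z ∈ Γ.target) :
    ContinuousAt (plaque Γ z) (Γ.symm z).2 := by
  have h : ContinuousAt Γ ((Γ.symm z).1, (Γ.symm z).2) := Γ.continuousAt (Γ.map_target hz)
  exact ContinuousAt.comp (f := fun y => ((Γ.symm z).1, y)) h (by fun_prop)

/-- Moving slightly along a plaque keeps the `x`-coordinate and stays in `S`. This makes leafwise
derivatives local in `S` and lets them be iterated as derivatives in `y`. -/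
theorem eventually_plaque_mem (hS : IsOpen S) (hSΓ : S ⊆ Γ.target) {z : M} (hz : z ∈ S) :
    ∀ᶠ y in 𝓝 (Γ.symm z).2, plaque Γ z y ∈ S ∧ Γ.symm (plaque Γ z y) = ((Γ.symm z).1, y) := by
  have h1 : ∀ᶠ y in 𝓝 (Γ.symm z).2, plaque Γ z y ∈ S :=
    continuousAt_plaque (hSΓ hz) (by rw [plaque_self (hSΓ hz)]; exact hS.mem_nhds hz)
  have h2 : ∀ᶠ y in 𝓝 (Γ.symm z).2, ((Γ.symm z).1, y) ∈ Γ.source :=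
    (show ContinuousAt (fun y => ((Γ.symm z).1, y)) (Γ.symm z).2 by fun_prop)
      (Γ.open_source.mem_nhds (Γ.map_target (hSΓ hz)))
  filter_upwards [h1, h2] with y h1 h2 using ⟨h1, Γ.left_inv h2⟩

theorem leafDeriv_apply {z : M} (hz : z ∈ Γ.target) (j : Fin q) (h : M → ℝ) :
    leafDeriv Γ j h z =
      fderiv ℝ (fun y => h (plaque Γ z y)) (Γ.symm z).2 (EuclideanSpace.single j 1) :=
  indicator_of_mem hz _

theorem eventuallyEq_plaque {G : Type*} (hS : IsOpen S) (hSΓ : S ⊆ Γ.target) {f g : M → G}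
    (h : EqOn f g S) {z : M} (hz : z ∈ S) :
    (fun y => f (plaque Γ z y)) =ᶠ[𝓝 (Γ.symm z).2] fun y => g (plaque Γ z y) := by
  filter_upwards [eventually_plaque_mem hS hSΓ hz] with y hy using h hy.1

theorem leafDeriv_congr (hS : IsOpen S) (hSΓ : S ⊆ Γ.target) {f g : M → ℝ} (h : EqOn f g S)
    (j : Fin q) : EqOn (leafDeriv Γ j f) (leafDeriv Γ j g) S := fun z hz => by
  rw [leafDeriv_apply (hSΓ hz), leafDeriv_apply (hSΓ hz),
    (eventuallyEq_plaque hS hSΓ h hz).fderiv_eq]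

theorem LeafDifferentiableOn.congr {G : Type*} [NormedAddCommGroup G] [NormedSpace ℝ G]
    (hS : IsOpen S) (hSΓ : S ⊆ Γ.target) {f g : M → G}
    (hf : LeafDifferentiableOn Γ S f) (h : EqOn g f S) : LeafDifferentiableOn Γ S g :=
  fun z hz => (hf z hz).congr_of_eventuallyEq (eventuallyEq_plaque hS hSΓ h hz)

theorem leafDeriv_const (j : Fin q) (c : ℝ) : leafDeriv Γ j (fun _ => c) = 0 := by
  ext z
  by_cases hz : z ∈ Γ.target
  · simp [leafDeriv_apply hz]
  · exact indicator_of_notMem hz _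

theorem leafDeriv_add (hSΓ : S ⊆ Γ.target) {f g : M → ℝ} (hf : LeafDifferentiableOn Γ S f)
    (hg : LeafDifferentiableOn Γ S g) (j : Fin q) :
    EqOn (leafDeriv Γ j fun z => f z + g z) (fun z => leafDeriv Γ j f z + leafDeriv Γ j g z) S :=
  fun z hz => by
  simp only [leafDeriv_apply (hSΓ hz)]
  rw [((hf z hz).hasFDerivAt.fun_add (hg z hz).hasFDerivAt).fderiv]
  rfl

theorem leafDeriv_mul (hSΓ : S ⊆ Γ.target) {f g : M → ℝ} (hf : LeafDifferentiableOn Γ S f)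
    (hg : LeafDifferentiableOn Γ S g) (j : Fin q) :
    EqOn (leafDeriv Γ j fun z => f z * g z)
      (fun z => f z * leafDeriv Γ j g z + leafDeriv Γ j f z * g z) S := fun z hz => by
  simp only [leafDeriv_apply (hSΓ hz)]
  rw [((hf z hz).hasFDerivAt.fun_mul (hg z hz).hasFDerivAt).fderiv]
  simp [plaque_self (hSΓ hz), mul_comm]

theorem leafDeriv_comp (hSΓ : S ⊆ Γ.target) {G : Type*} [NormedAddCommGroup G] [NormedSpace ℝ G]
    {f : M → G} (hf : LeafDifferentiableOn Γ S f) {β : G → ℝ} {z : M} (hz : z ∈ S)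
    (hβ : DifferentiableAt ℝ β (f z)) (j : Fin q) :
    leafDeriv Γ j (fun z => β (f z)) z =
      fderiv ℝ β (f z) (fderiv ℝ (fun y => f (plaque Γ z y)) (Γ.symm z).2
        (EuclideanSpace.single j 1)) := by
  rw [leafDeriv_apply (hSΓ hz)]
  have h : HasFDerivAt β (fderiv ℝ β (f z)) (f (plaque Γ z (Γ.symm z).2)) := by
    rw [plaque_self (hSΓ hz)]; exact hβ.hasFDerivAt
  exact congrArg (fun A => A (EuclideanSpace.single j 1)) (HasFDerivAt.comp (g := β)
    (f := fun y => f (plaque Γ z y)) _ h (hf z hz).hasFDerivAt).fderiv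

theorem LeafDifferentiableOn.comp (hSΓ : S ⊆ Γ.target) {G H : Type*} [NormedAddCommGroup G]
    [NormedSpace ℝ G] [NormedAddCommGroup H] [NormedSpace ℝ H]
    {f : M → G} (hf : LeafDifferentiableOn Γ S f) {β : G → H}
    (hβ : ∀ z ∈ S, DifferentiableAt ℝ β (f z)) : LeafDifferentiableOn Γ S fun z => β (f z) :=
  fun z hz => by
  have h : DifferentiableAt ℝ β (f (plaque Γ z (Γ.symm z).2)) := by
    rw [plaque_self (hSΓ hz)]; exact hβ z hz
  exact DifferentiableAt.comp (g := β) (f := fun y => f (plaque Γ z y)) _ h (hf z hz)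

theorem leafDeriv_coord (hSΓ : S ⊆ Γ.target) (hd : LeafDifferentiableOn Γ S φ) {z : M} (hz : z ∈ S)
    (j : Fin q) (l : Fin n) : leafDeriv Γ j (fun z => φ z l) z =
      fderiv ℝ (fun y => φ (plaque Γ z y)) (Γ.symm z).2 (EuclideanSpace.single j 1) l := by
  have := leafDeriv_comp hSΓ hd hz (β := fun x : Euc n => EuclideanSpace.proj (𝕜 := ℝ) l x)
    (ContinuousLinearMap.differentiableAt _) j
  rw [ContinuousLinearMap.fderiv] at this
  exact this

theorem leafDeriv_inner (hSΓ : S ⊆ Γ.target) (hd : LeafDifferentiableOn Γ S φ) {z : M}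
    (hz : z ∈ S) (j : Fin q) (ξ : Euc n) : leafDeriv Γ j (fun z => inner ℝ ξ (φ z)) z =
      ∑ l, ξ l * leafDeriv Γ j (fun z => φ z l) z := by
  have := leafDeriv_comp hSΓ hd hz (β := fun x : Euc n => innerSL ℝ ξ x)
    (ContinuousLinearMap.differentiableAt _) j
  rw [ContinuousLinearMap.fderiv] at this
  simp only [leafDeriv_coord hSΓ hd hz]
  refine this.trans ?_
  simp [PiLp.inner_apply, mul_comm]

theorem LeafClass.holderBound {k : ℕ} {f : ι → M → ℝ} (hf : LeafClass Γ φ S α k f) :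
    ∃ C, 0 ≤ C ∧ ∀ i, HolderBound φ S α C (f i) :=
  exists_nonneg_holderBound (by cases k; exacts [hf, hf.1])

/-- Used both to extract one member of a family (index `Unit`) and to view a single function as a
constant family. -/
theorem LeafClass.comp_index {k : ℕ} {f : ι → M → ℝ} (hf : LeafClass Γ φ S α k f) (g : κ → ι) :
    LeafClass Γ φ S α k fun i => f (g i) := by
  induction k generalizing f with
  | zero => exact hf.imp fun C h i => h (g i)
  | succ k ih =>
    exact ⟨hf.1.imp fun C h i => h (g i), fun i => hf.2.1 (g i), fun j => ih (hf.2.2 j)⟩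

theorem LeafClass.of_succ {k : ℕ} {f : ι → M → ℝ} (hf : LeafClass Γ φ S α (k + 1) f) :
    LeafClass Γ φ S α k f := by
  induction k generalizing f with
  | zero => exact hf.1
  | succ k ih => exact ⟨hf.1, hf.2.1, fun j => ih (hf.2.2 j)⟩

theorem LeafClass.of_le {k l : ℕ} (hkl : k ≤ l) {f : ι → M → ℝ} (hf : LeafClass Γ φ S α l f) :
    LeafClass Γ φ S α k f := by
  induction l, hkl using Nat.le_induction with
  | base => exact hf
  | succ l _ ih => exact ih hf.of_succ

variable (hS : IsOpen S) (hSΓ : S ⊆ Γ.target)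

include hS hSΓ

theorem LeafClass.congr {k : ℕ} {f g : ι → M → ℝ} (hf : LeafClass Γ φ S α k f)
    (h : ∀ i, EqOn (g i) (f i) S) : LeafClass Γ φ S α k g := by
  induction k generalizing f g with
  | zero => exact hf.imp fun C hC i => (hC i).congr (h i)
  | succ k ih =>
    exact ⟨hf.1.imp fun C hC i => (hC i).congr (h i), fun i => (hf.2.1 i).congr hS hSΓ (h i),
      fun j => ih (hf.2.2 j) fun i => leafDeriv_congr hS hSΓ (h i) j⟩

theorem LeafClass.const {k : ℕ} {c : ι → ℝ} {C : ℝ} (hc : ∀ i, |c i| ≤ C) :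
    LeafClass Γ φ S α k fun i _ => c i := by
  induction k generalizing c C with
  | zero => exact ⟨C, fun i => (HolderBound.const _).mono (hc i)⟩
  | succ k ih =>
    refine ⟨⟨C, fun i => (HolderBound.const _).mono (hc i)⟩,
      fun i z _ => differentiableAt_const _, fun j => ?_⟩
    exact (ih (c := fun _ => 0) (C := 0) (by simp)).congr hS hSΓ fun i z _ => by
      rw [leafDeriv_const]; rfl

theorem LeafClass.add {k : ℕ} {f g : ι → M → ℝ} (hf : LeafClass Γ φ S α k f)
    (hg : LeafClass Γ φ S α k g) : LeafClass Γ φ S α k fun i z => f i z + g i z := by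
  have h0 : ∃ C, ∀ i, HolderBound φ S α C fun z => f i z + g i z := by
    obtain ⟨C, _, hC⟩ := hf.holderBound
    obtain ⟨C', _, hC'⟩ := hg.holderBound
    exact ⟨_, fun i => (hC i).add (hC' i)⟩
  induction k generalizing f g with
  | zero => exact h0
  | succ k ih =>
    refine ⟨h0, fun i z hz => (hf.2.1 i z hz).add (hg.2.1 i z hz), fun j => ?_⟩
    refine (ih (hf.2.2 j) (hg.2.2 j) ?_).congr hS hSΓ fun i =>
      leafDeriv_add hSΓ (hf.2.1 i) (hg.2.1 i) j
    obtain ⟨C, _, hC⟩ := (hf.2.2 j).holderBound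
    obtain ⟨C', _, hC'⟩ := (hg.2.2 j).holderBound
    exact ⟨_, fun i => (hC i).add (hC' i)⟩

theorem LeafClass.mul {k : ℕ} {f g : ι → M → ℝ} (hf : LeafClass Γ φ S α k f)
    (hg : LeafClass Γ φ S α k g) : LeafClass Γ φ S α k fun i z => f i z * g i z := by
  have h0 : ∀ {k : ℕ} {f g : ι → M → ℝ}, LeafClass Γ φ S α k f → LeafClass Γ φ S α k g →
      ∃ C, ∀ i, HolderBound φ S α C fun z => f i z * g i z := fun hf hg => by
    obtain ⟨C, h, hC⟩ := hf.holderBound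
    obtain ⟨C', h', hC'⟩ := hg.holderBound
    exact ⟨_, fun i => (hC i).mul h h' (hC' i)⟩
  induction k generalizing f g with
  | zero => exact h0 hf hg
  | succ k ih =>
    refine ⟨h0 hf hg, fun i z hz => (hf.2.1 i z hz).mul (hg.2.1 i z hz), fun j => ?_⟩
    exact ((ih hf.of_succ (hg.2.2 j)).add hS hSΓ (ih (hf.2.2 j) hg.of_succ)).congr hS hSΓ
      fun i => leafDeriv_mul hSΓ (hf.2.1 i) (hg.2.1 i) j

theorem LeafClass.const_mul {k : ℕ} {c : ι → ℝ} {C : ℝ} (hc : ∀ i, |c i| ≤ C) {f : ι → M → ℝ}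
    (hf : LeafClass Γ φ S α k f) : LeafClass Γ φ S α k fun i z => c i * f i z :=
  (LeafClass.const hS hSΓ hc).mul hS hSΓ hf

theorem LeafClass.sum {k : ℕ} {σ : Type*} (s : Finset σ) {f : σ → ι → M → ℝ}
    (hf : ∀ a, LeafClass Γ φ S α k (f a)) :
    LeafClass Γ φ S α k fun i z => ∑ a ∈ s, f a i z := by
  classical
  induction s using Finset.induction_on with
  | empty =>
    simpa using LeafClass.const (ι := ι) (c := fun _ => 0) (C := 0) (k := k) (φ := φ) (α := α)
      hS hSΓ (by simp)
  | insert a s ha ih =>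
    simp only [Finset.sum_insert ha]
    exact (hf a).add hS hSΓ ih

/-- Since `V_j (1 / f) = -f⁻² V_j f`, one derivative of the inverse involves only the inverse
itself, to lower order. -/
theorem LeafClass.inv {k : ℕ} {f : ι → M → ℝ} (hf : LeafClass Γ φ S α k f) {c : ℝ} (hc : 0 < c)
    (hfc : ∀ i, ∀ z ∈ S, c ≤ |f i z|) : LeafClass Γ φ S α k fun i z => (f i z)⁻¹ := by
  have h0 : ∃ C, ∀ i, HolderBound φ S α C fun z => (f i z)⁻¹ := by
    obtain ⟨C, h, hC⟩ := hf.holderBound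
    exact ⟨_, fun i => (hC i).inv hc (hfc i)⟩
  have hne : ∀ i, ∀ z ∈ S, f i z ≠ 0 := fun i z hz => abs_pos.1 (hc.trans_le (hfc i z hz))
  induction k with
  | zero => exact h0
  | succ k ih =>
    have hd : ∀ i, ∀ z ∈ S, DifferentiableAt ℝ (fun x : ℝ => x⁻¹) (f i z) := fun i z hz =>
      differentiableAt_inv (hne i z hz)
    refine ⟨h0, fun i => (hf.2.1 i).comp hSΓ (hd i), fun j => ?_⟩
    have hi := ih hf.of_succ
    refine ((LeafClass.const (ι := ι) (c := fun _ => -1) (C := 1) hS hSΓ (by simp)).mul hS hSΓ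
      ((hi.mul hS hSΓ hi).mul hS hSΓ (hf.2.2 j))).congr hS hSΓ fun i z hz => ?_
    rw [leafDeriv_comp hSΓ (hf.2.1 i) hz (hd i z hz)]
    simp only [leafDeriv_apply (hSΓ hz)]
    rw [fderiv_eq_smul_deriv, deriv_inv, smul_eq_mul]
    ring

/-- Smooth functions of the coordinates `φ` are leafwise smooth if the coordinates are. -/
theorem LeafClass.smooth_comp {k : ℕ} {x₀ : Euc n} {ε : ℝ} (hε : ε ≤ 1 / 2) (hα : α ≤ 1)
    (hφS : ∀ z ∈ S, φ z ∈ Metric.ball x₀ ε)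
    (hφ : ∀ l, LeafClass Γ φ S α k fun (_ : Unit) z => φ z l)
    {β : Euc n → ℝ} (hβ : ContDiff ℝ ∞ β) :
    LeafClass Γ φ S α k fun (_ : Unit) z => β (φ z) := by
  induction k generalizing β with
  | zero => exact (HolderBound.exists_smooth_comp hε hα hφS hβ).imp fun C h _ => h
  | succ k ih =>
    have hd : LeafDifferentiableOn Γ S φ := fun z hz =>
      differentiableAt_euclidean.2 fun l => (hφ l).2.1 () z hz
    have hβd : Differentiable ℝ β := hβ.differentiable (by simp)
    refine ⟨(HolderBound.exists_smooth_comp hε hα hφS hβ).imp fun C h _ => h,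
      fun _ => hd.comp hSΓ fun z _ => hβd _, fun j => ?_⟩
    -- Chain rule `V_j (β ∘ φ) = ∑ₗ (∂ₗβ ∘ φ) V_j φₗ`; the `∂ₗβ` are again smooth, so the induction
    -- hypothesis covers them.
    refine (LeafClass.sum hS hSΓ (ι := Unit) Finset.univ fun l : Fin n =>
      (ih (fun l => (hφ l).of_succ)
        (β := fun x => fderiv ℝ β x (EuclideanSpace.single l 1))
        ((hβ.fderiv_right (m := ∞) (by simp)).clm_apply contDiff_const)).mul hS hSΓ
          ((hφ l).2.2 j)).congr hS hSΓ fun _ z hz => ?_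
    rw [leafDeriv_comp hSΓ hd hz (hβd _)]
    set v := fderiv ℝ (fun y => φ (plaque Γ z y)) (Γ.symm z).2 (EuclideanSpace.single j 1) with hv
    have hl : ∀ l, leafDeriv Γ j (fun z => φ z l) z = v l := fun l => leafDeriv_coord hSΓ hd hz j l
    simp only [hl]
    conv_lhs => rw [← (EuclideanSpace.basisFun (Fin n) ℝ).sum_repr v]
    simp [mul_comm]

end LeafClass

/-! ### Integration by parts along the leaves. -/

section Decay

variable {n p q : ℕ} {M : Type*} [TopologicalSpace M] {ι : Type*}
  {Γ : OpenPartialHomeomorph (Euc p × Euc q) M} {φ : M → Euc n} {S K : Set M} {α : ℝ}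

theorem leafDeriv_eq_zero (hK : IsClosed K) {f : M → ℝ} (hf : ∀ z ∉ K, f z = 0) (j : Fin q) :
    ∀ z ∉ K, leafDeriv Γ j f z = 0 := fun z hz => by
  by_cases hzΓ : z ∈ Γ.target
  · have h : EqOn f (fun _ => 0) (Γ.target ∩ Kᶜ) := fun z hz => hf z hz.2
    rw [leafDeriv_congr (Γ.open_target.inter hK.isOpen_compl) inter_subset_left h j ⟨hzΓ, hz⟩,
      leafDeriv_const]
    rfl
  · exact indicator_of_notMem hzΓ _

theorem iterate_leafDeriv_eq_zero (hK : IsClosed K) {f : M → ℝ} (hf : ∀ z ∉ K, f z = 0)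
    (j : Fin q) (m : ℕ) : ∀ z ∉ K, (leafDeriv Γ j)^[m] f z = 0 := by
  induction m generalizing f with
  | zero => exact hf
  | succ m ih => exact ih (leafDeriv_eq_zero hK hf j)

theorem iterate_leafDeriv_congr (hS : IsOpen S) (hSΓ : S ⊆ Γ.target) {f g : M → ℝ}
    (h : EqOn f g S) (j : Fin q) (m : ℕ) :
    EqOn ((leafDeriv Γ j)^[m] f) ((leafDeriv Γ j)^[m] g) S := by
  induction m generalizing f g with
  | zero => exact h
  | succ m ih => exact ih (leafDeriv_congr hS hSΓ h j)

theorem leafDeriv_const_mul_sub (hSΓ : S ⊆ Γ.target) {f g : M → ℝ}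
    (hf : LeafDifferentiableOn Γ S f) (hg : LeafDifferentiableOn Γ S g) (c : ℝ) (j : Fin q) :
    EqOn (leafDeriv Γ j fun z => c * (f z - g z))
      (fun z => c * (leafDeriv Γ j f z - leafDeriv Γ j g z)) S := fun z hz => by
  simp only [leafDeriv_apply (hSΓ hz)]
  rw [(((hf z hz).hasFDerivAt.fun_sub (hg z hz).hasFDerivAt).const_mul c).fderiv]
  rfl

theorem LeafClass.iterate {k m : ℕ} {f : ι → M → ℝ} (hf : LeafClass Γ φ S α (m + k) f)
    (j : Fin q) : LeafClass Γ φ S α k fun i => (leafDeriv Γ j)^[m] (f i) := by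
  induction m generalizing f with
  | zero => rwa [Nat.zero_add] at hf
  | succ m ih =>
    rw [Nat.add_right_comm] at hf
    exact ih (hf.2.2 j)

theorem iterate_leafDeriv_const_mul_sub (hS : IsOpen S) (hSΓ : S ⊆ Γ.target) {f g : M → ℝ} {m : ℕ}
    (hf : LeafClass Γ φ S α m fun _ : Unit => f) (hg : LeafClass Γ φ S α m fun _ : Unit => g)
    (c : ℝ) (j : Fin q) :
    EqOn ((leafDeriv Γ j)^[m] fun z => c * (f z - g z))
      (fun z => c * ((leafDeriv Γ j)^[m] f z - (leafDeriv Γ j)^[m] g z)) S := by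
  induction m generalizing f g with
  | zero => exact fun z _ => rfl
  | succ m ih =>
    exact (iterate_leafDeriv_congr hS hSΓ
      (leafDeriv_const_mul_sub hSΓ (hf.2.1 ()) (hg.2.1 ()) c j) j m).trans
        (ih (hf.2.2 j) (hg.2.2 j))

theorem leafDeriv_mul_sin (hSΓ : S ⊆ Γ.target) {a ψ : M → ℝ} (ha : LeafDifferentiableOn Γ S a)
    (hψ : LeafDifferentiableOn Γ S ψ) (l θ : ℝ) (j : Fin q) {z : M} (hz : z ∈ S) :
    leafDeriv Γ j (fun z => a z * Real.sin (l * ψ z + θ)) z =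
      l * (a z * leafDeriv Γ j ψ z * Real.cos (l * ψ z + θ)) +
        leafDeriv Γ j a z * Real.sin (l * ψ z + θ) := by
  have hd : ∀ x : ℝ, HasDerivAt (fun x => Real.sin (l * x + θ)) (Real.cos (l * x + θ) * l) x :=
    fun x => by simpa using (((hasDerivAt_id x).const_mul l).add_const θ).sin
  rw [leafDeriv_mul hSΓ ha (hψ.comp hSΓ fun z _ => (hd (ψ z)).differentiableAt) j hz]
  beta_reduce
  rw [leafDeriv_comp hSΓ hψ hz (hd (ψ z)).differentiableAt]
  simp only [leafDeriv_apply (hSΓ hz)]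
  rw [fderiv_eq_smul_deriv, (hd _).deriv, smul_eq_mul]
  ring

/-- Nonstationary phase: integrating by parts along the leaves, a functional whose leafwise
derivatives are dual to Hölder functions decays rapidly on oscillating functions. -/
theorem exists_decay {𝕜 : Type*} [RCLike 𝕜] (hS : IsOpen S) (hSΓ : S ⊆ Γ.target)
    (hK : IsClosed K) (hKS : K ⊆ S) {N : ℕ} {j : Fin q} {D : (M → ℝ) → 𝕜}
    (hDlin : ∀ f g : M → ℝ, (∀ z ∉ K, f z = 0) → (∀ z ∉ K, g z = 0) →
      (∃ C, HolderBound φ S α C f) → (∃ C, HolderBound φ S α C g) → ∀ c : ℝ,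
      D (fun z => c * (f z - g z)) = (c : 𝕜) * (D f - D g))
    -- The leafwise class only makes `f` admissible; the bound sees the `α`-Hölder norm alone.
    (hDb : ∀ m ≤ N, ∃ C, ∀ f : M → ℝ, (∀ z ∉ K, f z = 0) →
      LeafClass Γ φ S α m (fun _ : Unit => f) → ∀ B, 0 ≤ B → HolderBound φ S α B f →
      ‖D ((leafDeriv Γ j)^[m] f)‖ ≤ C * B)
    {ψ : ι → M → ℝ} {c : ℝ} (hc : 0 < c)
    (hψα : ∀ i, ∀ z ∈ S, ∀ z' ∈ S, |ψ i z - ψ i z'| ≤ dist (φ z) (φ z') ^ α)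
    (hψd : ∀ i, LeafDifferentiableOn Γ S (ψ i))
    (hψc : ∀ i, ∀ z ∈ S, c ≤ |leafDeriv Γ j (ψ i) z|)
    (hψj : LeafClass Γ φ S α N fun i => leafDeriv Γ j (ψ i))
    -- No uniformity in `l`: higher leafwise derivatives of the cosine may grow with `l`, and only
    -- membership in the class matters.
    (hψe : ∀ i l θ, LeafClass Γ φ S α N fun (_ : Unit) z => Real.cos (l * ψ i z + θ))
    (k m : ℕ) (hmk : m + k ≤ N) (b : ι → M → ℝ) (hbK : ∀ i, ∀ z ∉ K, b i z = 0)
    (hb : LeafClass Γ φ S α (m + k) b) :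
    ∃ C, ∀ i l θ, 1 ≤ l →
      ‖D ((leafDeriv Γ j)^[m] fun z => b i z * Real.cos (l * ψ i z + θ))‖ ≤ C * l / l ^ k := by
  -- `k` counts the integrations by parts still to be made, `m` the leafwise derivatives already
  -- moved onto `D`.
  induction k generalizing m b with
  | zero =>
    obtain ⟨C, hC⟩ := hDb m (by omega)
    obtain ⟨B, hB0, hB⟩ := hb.holderBound
    -- `2 * B * l` is the product bound for an amplitude bounded by `B` and a cosine bounded by `l`.
    refine ⟨C * (2 * B), fun i l θ hl => ?_⟩
    have hl0 : 0 ≤ l := zero_le_one.trans hl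
    refine (hC _ (fun z hz => by simp [hbK i z hz])
      ((hb.comp_index fun _ => i).mul hS hSΓ ((hψe i l θ).of_le hmk)) (2 * B * l) (by positivity)
      ((hB i).mul hB0 hl0 (HolderBound.cos hl (hψα i)))).trans (le_of_eq ?_)
    ring
  | succ k ih =>
    have ha : LeafClass Γ φ S α (m + (k + 1)) fun i z => b i z * (leafDeriv Γ j (ψ i) z)⁻¹ :=
      hb.mul hS hSΓ ((hψj.of_le hmk).inv hS hSΓ hc hψc)
    set a : ι → M → ℝ := fun i z => b i z * (leafDeriv Γ j (ψ i) z)⁻¹ with ha_def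
    have haK : ∀ i, ∀ z ∉ K, a i z = 0 := fun i z hz => by simp [ha_def, hbK i z hz]
    have haK' : ∀ i, ∀ z ∉ K, leafDeriv Γ j (a i) z = 0 := fun i =>
      leafDeriv_eq_zero hK (haK i) j
    have ha1 : LeafClass Γ φ S α (m + k + 1) a := ha
    obtain ⟨C₁, h₁⟩ := ih (m + 1) (by omega) a haK
      (by rwa [show m + 1 + k = m + (k + 1) by omega])
    obtain ⟨C₂, h₂⟩ := ih m (by omega) (fun i => leafDeriv Γ j (a i)) haK' (ha1.2.2 j)
    refine ⟨C₁ + C₂, fun i l θ hl => ?_⟩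
    have hl0 : 0 < l := zero_lt_one.trans_le hl
    -- A shift of the phase turns cosines into sines, so the induction hypothesis for all `θ`
    -- handles both.
    set θ' := θ - Real.pi / 2 with hθ'
    have hsin : ∀ z, Real.cos (l * ψ i z + θ') = Real.sin (l * ψ i z + θ) := fun z => by
      rw [← Real.cos_sub_pi_div_two, hθ', add_sub_assoc]
    set f₁ := leafDeriv Γ j fun z => a i z * Real.cos (l * ψ i z + θ') with hf₁
    set f₂ : M → ℝ := fun z => leafDeriv Γ j (a i) z * Real.cos (l * ψ i z + θ') with hf₂
    have hf₀ : LeafClass Γ φ S α (m + 1) fun (_ : Unit) z => a i z * Real.cos (l * ψ i z + θ') :=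
      ((ha.comp_index fun _ => i).of_le (by omega)).mul hS hSΓ ((hψe i l θ').of_le (by omega))
    have hf₁c : LeafClass Γ φ S α m fun _ : Unit => f₁ := hf₀.2.2 j
    have hf₂c : LeafClass Γ φ S α m fun _ : Unit => f₂ :=
      (((ha1.2.2 j).comp_index fun _ => i).of_le (by omega)).mul hS hSΓ
        ((hψe i l θ').of_le (by omega))
    have hf₁K : ∀ z ∉ K, f₁ z = 0 := leafDeriv_eq_zero hK (fun z hz => by simp [haK i z hz]) j
    have hf₂K : ∀ z ∉ K, f₂ z = 0 := fun z hz => by simp [hf₂, haK' i z hz]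
    have key : EqOn (fun z => b i z * Real.cos (l * ψ i z + θ))
        (fun z => l⁻¹ * (f₁ z - f₂ z)) S := fun z hz => by
      have hne : leafDeriv Γ j (ψ i) z ≠ 0 := abs_pos.1 (hc.trans_le (hψc i z hz))
      simp only [hf₁, hf₂, hsin]
      rw [leafDeriv_mul_sin hSΓ (ha1.2.1 i) (hψd i) l θ j hz]
      simp only [ha_def]
      field_simp
      ring
    -- The identity `key` is available only on `S`; off `K ⊆ S` every term vanishes.
    have hV : ((leafDeriv Γ j)^[m] fun z => b i z * Real.cos (l * ψ i z + θ)) =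
        fun z => l⁻¹ * ((leafDeriv Γ j)^[m] f₁ z - (leafDeriv Γ j)^[m] f₂ z) := by
      funext z
      by_cases hz : z ∈ K
      · rw [iterate_leafDeriv_congr hS hSΓ key j m (hKS hz),
          iterate_leafDeriv_const_mul_sub hS hSΓ hf₁c hf₂c _ j (hKS hz)]
      · rw [iterate_leafDeriv_eq_zero hK (fun z hz => by simp [hbK i z hz]) j m z hz,
          iterate_leafDeriv_eq_zero hK hf₁K j m z hz, iterate_leafDeriv_eq_zero hK hf₂K j m z hz]
        simp
    have hb₁ : ∃ C, HolderBound φ S α C ((leafDeriv Γ j)^[m] f₁) := by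
      obtain ⟨C, _, hC⟩ := (LeafClass.iterate (k := 0) hf₁c j).holderBound
      exact ⟨C, hC ()⟩
    have hb₂ : ∃ C, HolderBound φ S α C ((leafDeriv Γ j)^[m] f₂) := by
      obtain ⟨C, _, hC⟩ := (LeafClass.iterate (k := 0) hf₂c j).holderBound
      exact ⟨C, hC ()⟩
    rw [hV, hDlin _ _ (iterate_leafDeriv_eq_zero hK hf₁K j m)
      (iterate_leafDeriv_eq_zero hK hf₂K j m) hb₁ hb₂, norm_mul]
    have e₁ := h₁ i l θ' hl
    have e₂ := h₂ i l θ' hl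
    rw [Function.iterate_succ_apply] at e₁
    have hn : ‖((l⁻¹ : ℝ) : 𝕜)‖ = l⁻¹ := by
      rw [RCLike.norm_ofReal, abs_of_pos (inv_pos.2 hl0)]
    rw [hn]
    calc _ ≤ l⁻¹ * (C₁ * l / l ^ k + C₂ * l / l ^ k) :=
          mul_le_mul_of_nonneg_left ((norm_sub_le _ _).trans (add_le_add e₁ e₂))
            (inv_nonneg.2 hl0.le)
      _ = _ := by field_simp; ring

end Decay

/-! ### Hölder regularity of the chart coordinates along the leaves. -/

section LocalHolder

variable {n p q : ℕ} {M : Type*} [TopologicalSpace M]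

/-- The preimage under the chart `φ` of the ball of radius `ε` about `φ z₀`. -/
def chartBall (φ : OpenPartialHomeomorph M (Euc n)) (z₀ : M) (ε : ℝ) : Set M :=
  φ.source ∩ φ ⁻¹' Metric.ball (φ z₀) ε

theorem isOpen_chartBall (φ : OpenPartialHomeomorph M (Euc n)) (z₀ : M) (ε : ℝ) :
    IsOpen (chartBall φ z₀ ε) :=
  φ.isOpen_inter_preimage Metric.isOpen_ball

theorem mem_chartBall_self {φ : OpenPartialHomeomorph M (Euc n)} {z₀ : M} (hz₀ : z₀ ∈ φ.source)
    {ε : ℝ} (hε : 0 < ε) : z₀ ∈ chartBall φ z₀ ε :=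
  ⟨hz₀, Metric.mem_ball_self hε⟩

theorem chartBall_mono {φ : OpenPartialHomeomorph M (Euc n)} {z₀ : M} {ε δ : ℝ} (h : ε ≤ δ) :
    chartBall φ z₀ ε ⊆ chartBall φ z₀ δ :=
  inter_subset_inter_right _ (preimage_mono (Metric.ball_subset_ball h))

theorem exists_chartBall_subset {φ : OpenPartialHomeomorph M (Euc n)} {z₀ : M}
    (hz₀ : z₀ ∈ φ.source) {t : Set (Euc n)} (ht : t ∈ 𝓝 (φ z₀)) :
    ∃ ε > 0, Metric.ball (φ z₀) ε ⊆ t ∩ φ.target := by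
  obtain ⟨ε, hε, h⟩ := Metric.mem_nhds_iff.1
    (Filter.inter_mem ht (φ.open_target.mem_nhds (φ.map_source hz₀)))
  exact ⟨ε, hε, h⟩

theorem eventually_chartBall_subset {φ : OpenPartialHomeomorph M (Euc n)} {z₀ : M}
    (hz₀ : z₀ ∈ φ.source) {O : Set M} (hO : O ∈ 𝓝 z₀) :
    ∀ᶠ ε in 𝓝[>] (0 : ℝ), chartBall φ z₀ ε ⊆ O := by
  have h : φ.symm ⁻¹' O ∈ 𝓝 (φ z₀) :=
    φ.continuousAt_symm (φ.map_source hz₀) (by rwa [φ.left_inv hz₀])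
  obtain ⟨ε, hε, h⟩ := exists_chartBall_subset hz₀ h
  filter_upwards [Ioo_mem_nhdsGT hε] with δ hδ z hz
  have := (h (Metric.ball_subset_ball hδ.2.le hz.2)).1
  rwa [mem_preimage, φ.left_inv hz.1] at this

theorem eventually_closedBall_subset_target {φ : OpenPartialHomeomorph M (Euc n)} {z₀ : M}
    (hz₀ : z₀ ∈ φ.source) : ∀ᶠ ε in 𝓝[>] (0 : ℝ), Metric.closedBall (φ z₀) ε ⊆ φ.target := by
  obtain ⟨ε, hε, h⟩ := exists_chartBall_subset hz₀ (Filter.univ_mem)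
  filter_upwards [Ioo_mem_nhdsGT hε] with δ hδ
  exact (Metric.closedBall_subset_ball hδ.2).trans (h.trans inter_subset_right)

theorem _root_.ContDiffAt.differentiableAt_iteratedFDeriv_infty {E G : Type*}
    [NormedAddCommGroup E] [NormedSpace ℝ E] [NormedAddCommGroup G] [NormedSpace ℝ G] {f : E → G}
    {x : E} (hf : ContDiffAt ℝ ∞ f x) (k : ℕ) : DifferentiableAt ℝ (iteratedFDeriv ℝ k f) x :=
  (hf.iteratedFDeriv_right (m := 1) (by exact_mod_cast le_top)).differentiableAt (by simp)

variable [ChartedSpace (Euc n) M] {Γ : OpenPartialHomeomorph (Euc p × Euc q) M}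
  {φ : OpenPartialHomeomorph M (Euc n)}

/-- The plaquewise derivative of order `k` of the coordinates `φ`. -/
noncomputable def plaqueJet (Γ : OpenPartialHomeomorph (Euc p × Euc q) M) (φ : M → Euc n) (k : ℕ)
    (w : Euc p × Euc q) : Euc q [×k]→L[ℝ] Euc n :=
  iteratedFDeriv ℝ k (fun y => φ (Γ (w.1, y))) w.2

omit [ChartedSpace (Euc n) M] in
theorem leafDerivs_coord_step (h : ∀ w ∈ Γ.source ∩ Γ ⁻¹' φ.source,
      ContDiffAt ℝ ∞ (fun y => φ (Γ (w.1, y))) w.2) {k : ℕ} {f : M → ℝ} {m : Fin k → Euc q}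
    {l : Fin n} (hf : ∀ z ∈ Γ.target ∩ φ.source, f z = plaqueJet Γ φ k (Γ.symm z) m l)
    {z : M} (hz : z ∈ Γ.target ∩ φ.source) :
    HasFDerivAt (fun y => f (plaque Γ z y)) ((EuclideanSpace.proj l).comp
      ((ContinuousMultilinearMap.apply ℝ (fun _ : Fin k => Euc q) (Euc n) m).comp
        (fderiv ℝ (iteratedFDeriv ℝ k fun y => φ (plaque Γ z y)) (Γ.symm z).2)))
      (Γ.symm z).2 := by
  have hd := ((h (Γ.symm z) ⟨Γ.map_target hz.1, by
    rw [mem_preimage, Γ.right_inv hz.1]; exact hz.2⟩).differentiableAt_iteratedFDeriv_infty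
      k).hasFDerivAt
  have hd' := (EuclideanSpace.proj l : Euc n →L[ℝ] ℝ).hasFDerivAt.comp
    (Γ.symm z).2 ((ContinuousMultilinearMap.apply ℝ (fun _ : Fin k => Euc q) (Euc n)
      m).hasFDerivAt.comp (Γ.symm z).2 hd)
  refine hd'.congr_of_eventuallyEq ?_
  filter_upwards [eventually_plaque_mem (Γ.open_target.inter φ.open_source) inter_subset_left hz]
    with y hy
  rw [hf _ hy.1, hy.2]
  rfl

-- In the coordinates `(x, y)` the fields `V_j` are constant, so each new outermost derivative adds
-- a first argument to the iterated derivative in `y`.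
omit [ChartedSpace (Euc n) M] in
theorem leafDerivs_coord (h : ∀ w ∈ Γ.source ∩ Γ ⁻¹' φ.source,
      ContDiffAt ℝ ∞ (fun y => φ (Γ (w.1, y))) w.2) (js : List (Fin q)) (l : Fin n) :
    ∀ z ∈ Γ.target ∩ φ.source, leafDerivs Γ js (fun z => φ z l) z =
      plaqueJet Γ φ js.length (Γ.symm z) (fun i => EuclideanSpace.single (js.get i) 1) l := by
  induction js with
  | nil => intro z hz; simp [leafDerivs, plaqueJet, Γ.right_inv hz.1]
  | cons j js ih =>
    intro z hz
    have hs := leafDerivs_coord_step h ih hz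
    calc leafDerivs Γ (j :: js) (fun z => φ z l) z
        = fderiv ℝ (fun y => leafDerivs Γ js (fun z => φ z l) (plaque Γ z y)) (Γ.symm z).2
            (EuclideanSpace.single j 1) := leafDeriv_apply hz.1 _ _
      _ = _ := by
        rw [hs.fderiv]
        simp only [plaqueJet, List.length_cons, iteratedFDeriv_succ_apply_left]
        rfl

omit [ChartedSpace (Euc n) M] in
theorem leafDifferentiableOn_leafDerivs_coord (h : ∀ w ∈ Γ.source ∩ Γ ⁻¹' φ.source,
      ContDiffAt ℝ ∞ (fun y => φ (Γ (w.1, y))) w.2) (js : List (Fin q)) (l : Fin n) :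
    LeafDifferentiableOn Γ (Γ.target ∩ φ.source) (leafDerivs Γ js fun z => φ z l) :=
  fun _ hz => (leafDerivs_coord_step h (leafDerivs_coord h js l) hz).differentiableAt

/-- The jet is Hölder in `(x, y)`, and `(x, y)` is Hölder in `φ z`; the exponents multiply. -/
theorem exists_holder_leafDerivs_coord (hΓ : IsHolderFoliationChart n Γ)
    (hφ : φ ∈ atlas (Euc n) M) {z₀ : M} (hz₀ : z₀ ∈ Γ.target ∩ φ.source) (js : List (Fin q))
    (l : Fin n) : ∃ a > 0, ∃ C, 0 ≤ C ∧ ∃ ε > 0, ∀ z ∈ chartBall φ z₀ ε, ∀ z' ∈ chartBall φ z₀ ε,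
      |leafDerivs Γ js (fun z => φ z l) z - leafDerivs Γ js (fun z => φ z l) z'| ≤
        C * dist (φ z) (φ z') ^ (a : ℝ) := by
  have hs₁ : IsOpen (Γ.source ∩ Γ ⁻¹' φ.source) := Γ.isOpen_inter_preimage φ.open_source
  have hs₂ : IsOpen (φ.target ∩ φ.symm ⁻¹' Γ.target) :=
    φ.symm.isOpen_inter_preimage Γ.open_target
  have hw₀ : Γ.symm z₀ ∈ Γ.source ∩ Γ ⁻¹' φ.source :=
    ⟨Γ.map_target hz₀.1, by rw [mem_preimage, Γ.right_inv hz₀.1]; exact hz₀.2⟩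
  have hp₀ : φ z₀ ∈ φ.target ∩ φ.symm ⁻¹' Γ.target :=
    ⟨φ.map_source hz₀.2, by rw [mem_preimage, φ.left_inv hz₀.2]; exact hz₀.1⟩
  obtain ⟨t₁, ht₁, C₁, a₁, ha₁, -, h₁⟩ := (hΓ.smoothHolder φ hφ).2 js.length _ hw₀
  obtain ⟨t₂, ht₂, C₂, a₂, ha₂, -, h₂⟩ := hΓ.holder_symm φ hφ _ hp₀
  rw [hs₁.nhdsWithin_eq hw₀] at ht₁
  rw [hs₂.nhdsWithin_eq hp₀] at ht₂
  have hc : ContinuousAt (fun x => Γ.symm (φ.symm x)) (φ z₀) := by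
    refine ContinuousAt.comp (g := Γ.symm) ?_ (φ.continuousAt_symm hp₀.1)
    exact Γ.continuousAt_symm hp₀.2
  have ht₃ : (fun x => Γ.symm (φ.symm x)) ⁻¹' t₁ ∈ 𝓝 (φ z₀) :=
    hc (by simpa only [φ.left_inv hz₀.2] using ht₁)
  obtain ⟨ε, hε, hball⟩ := exists_chartBall_subset hz₀.2
    (Filter.inter_mem (Filter.inter_mem ht₂ ht₃) (hs₂.mem_nhds hp₀))
  have hcomp := h₁.comp (h₂.mono (inter_subset_left (t := (fun x => Γ.symm (φ.symm x)) ⁻¹' t₁)))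
    (fun x hx => hx.2)
  refine ⟨(a₁ * a₂ : ℝ≥0), by positivity, (C₁ * C₂ ^ (a₁ : ℝ) : ℝ≥0), NNReal.coe_nonneg _, ε, hε,
    fun z hz z' hz' => ?_⟩
  have hb := hball hz.2
  have hb' := hball hz'.2
  have hd := hcomp.dist_le hb.1.1 hb'.1.1
  have hm : z ∈ Γ.target ∩ φ.source := ⟨by simpa [φ.left_inv hz.1] using hb.1.2.2, hz.1⟩
  have hm' : z' ∈ Γ.target ∩ φ.source := ⟨by simpa [φ.left_inv hz'.1] using hb'.1.2.2, hz'.1⟩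
  have hsm := fun w hw => (hΓ.smoothHolder φ hφ).1 w hw
  rw [leafDerivs_coord hsm js l z hm, leafDerivs_coord hsm js l z' hm']
  simp only [Function.comp_apply, φ.left_inv hz.1, φ.left_inv hz'.1] at hd
  refine le_trans ?_ hd
  change _ ≤ dist (plaqueJet Γ φ js.length (Γ.symm z)) (plaqueJet Γ φ js.length (Γ.symm z'))
  set A := plaqueJet Γ φ js.length (Γ.symm z)
  set B := plaqueJet Γ φ js.length (Γ.symm z')
  set m : Fin js.length → Euc q := fun i => EuclideanSpace.single (js.get i) 1
  calc |A m l - B m l| = ‖((A - B) m) l‖ := by simp [Real.norm_eq_abs]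
    _ ≤ ‖(A - B) m‖ := PiLp.norm_apply_le _ _
    _ ≤ ‖A - B‖ * ∏ i, ‖m i‖ := (A - B).le_opNorm m
    _ = dist A B := by simp [m, dist_eq_norm]

/-- On small balls distances are at most `1`, so every smaller exponent works too. With `α` chosen
before `ε`, finitely many derivatives can share one exponent and then one ball. -/
theorem eventually_holderBound_leafDerivs_coord (hΓ : IsHolderFoliationChart n Γ)
    (hφ : φ ∈ atlas (Euc n) M) {z₀ : M} (hz₀ : z₀ ∈ Γ.target ∩ φ.source) (js : List (Fin q))
    (l : Fin n) : ∀ᶠ α in 𝓝[>] (0 : ℝ), ∀ᶠ ε in 𝓝[>] (0 : ℝ),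
      ∃ C, HolderBound φ (chartBall φ z₀ ε) α C (leafDerivs Γ js fun z => φ z l) := by
  obtain ⟨a, ha, C, hC, δ, hδ, h⟩ := exists_holder_leafDerivs_coord hΓ hφ hz₀ js l
  filter_upwards [Ioo_mem_nhdsGT ha] with α hα
  filter_upwards [Ioo_mem_nhdsGT hδ, Ioo_mem_nhdsGT (show (0 : ℝ) < 1 / 2 by norm_num)]
    with ε hε hε'
  set f := leafDerivs Γ js fun z => φ z l
  have hH : ∀ z ∈ chartBall φ z₀ ε, ∀ z' ∈ chartBall φ z₀ ε,
      |f z - f z'| ≤ C * dist (φ z) (φ z') ^ α ∧ dist (φ z) (φ z') ≤ 1 := fun z hz z' hz' => by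
    have hd : dist (φ z) (φ z') ≤ 1 := by
      have h1 := dist_triangle_right (φ z) (φ z') (φ z₀)
      have h2 : dist (φ z) (φ z₀) < ε := hz.2
      have h3 : dist (φ z') (φ z₀) < ε := hz'.2
      linarith [hε'.2]
    refine ⟨(h z (chartBall_mono hε.2.le hz) z' (chartBall_mono hε.2.le hz')).trans
      (mul_le_mul_of_nonneg_left ?_ hC), hd⟩
    rcases (dist_nonneg (x := φ z) (y := φ z')).eq_or_lt with h0 | h0
    · rw [← h0, Real.zero_rpow ha.ne', Real.zero_rpow hα.1.ne']
    · exact Real.rpow_le_rpow_of_exponent_ge h0 hd hα.2.le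
  refine ⟨|f z₀| + C, fun z hz => ?_, fun z hz z' hz' => (hH z hz z' hz').1.trans
    (mul_le_mul_of_nonneg_right (by simp) (Real.rpow_nonneg dist_nonneg _))⟩
  obtain ⟨h1, h2⟩ := hH z hz z₀ (mem_chartBall_self hz₀.2 hε.1)
  have h3 : C * dist (φ z) (φ z₀) ^ α ≤ C :=
    mul_le_of_le_one_right hC (Real.rpow_le_one dist_nonneg h2 hα.1.le)
  have h4 := abs_sub_abs_le_abs_sub (f z) (f z₀)
  linarith

omit [ChartedSpace (Euc n) M] in
theorem leafClass_of_leafDerivs {ψ : M → Euc n} {S : Set M} {α : ℝ} {N : ℕ} {f : M → ℝ}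
    (hH : ∀ js : List (Fin q), js.length ≤ N → ∃ C, HolderBound ψ S α C (leafDerivs Γ js f))
    (hd : ∀ js : List (Fin q), LeafDifferentiableOn Γ S (leafDerivs Γ js f)) :
    LeafClass Γ ψ S α N fun _ : Unit => f := by
  induction N generalizing f with
  | zero => exact (hH [] (by simp)).imp fun C h _ => h
  | succ N ih =>
    -- The last entry of the list is the innermost derivative, which is the one that `LeafClass`
    -- takes first.
    have e : ∀ js j, leafDerivs Γ js (leafDeriv Γ j f) = leafDerivs Γ (js ++ [j]) f := fun js j => by
      simp [leafDerivs]
    exact ⟨(hH [] (by simp)).imp fun C h _ => h, fun _ => hd [], fun j =>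
      ih (fun js hjs => e js j ▸ hH _ (by simpa using hjs)) fun js => e js j ▸ hd _⟩

/-- Near every point the coordinates `φ` are leafwise smooth, to any given order. -/
theorem eventually_leafClass_coord (hΓ : IsHolderFoliationChart n Γ)
    (hφ : φ ∈ atlas (Euc n) M) {z₀ : M} (hz₀ : z₀ ∈ Γ.target ∩ φ.source) (N : ℕ) :
    ∀ᶠ α in 𝓝[>] (0 : ℝ), ∀ᶠ ε in 𝓝[>] (0 : ℝ),
      ∀ l, LeafClass Γ φ (chartBall φ z₀ ε) α N fun (_ : Unit) z => φ z l := by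
  have hfin := List.finite_length_le (Fin q) N
  have h : ∀ᶠ α in 𝓝[>] (0 : ℝ), ∀ l : Fin n, ∀ js ∈ {js : List (Fin q) | js.length ≤ N},
      ∀ᶠ ε in 𝓝[>] (0 : ℝ),
        ∃ C, HolderBound φ (chartBall φ z₀ ε) α C (leafDerivs Γ js fun z => φ z l) :=
    Filter.eventually_all.2 fun l => (Filter.eventually_all_finite hfin).2 fun js _ =>
      eventually_holderBound_leafDerivs_coord hΓ hφ hz₀ js l
  filter_upwards [h] with α hα
  have h' : ∀ᶠ ε in 𝓝[>] (0 : ℝ), ∀ l : Fin n, ∀ js ∈ {js : List (Fin q) | js.length ≤ N},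
        ∃ C, HolderBound φ (chartBall φ z₀ ε) α C (leafDerivs Γ js fun z => φ z l) :=
    Filter.eventually_all.2 fun l => (Filter.eventually_all_finite hfin).2 fun js hjs => hα l js hjs
  filter_upwards [h', eventually_chartBall_subset hz₀.2
    ((Γ.open_target.inter φ.open_source).mem_nhds hz₀)] with ε hε hsub l
  exact leafClass_of_leafDerivs (hε l) fun js z hz =>
    leafDifferentiableOn_leafDerivs_coord (fun w hw => (hΓ.smoothHolder φ hφ).1 w hw) js l z
      (hsub hz)

end LocalHolder

/-! ### From local Hölder bounds to the dual spaces. -/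

section Dual

variable {n p q : ℕ} {M : Type*} [TopologicalSpace M] {φ : OpenPartialHomeomorph M (Euc n)}
  {Γ : OpenPartialHomeomorph (Euc p × Euc q) M} {z₀ : M} {ε : ℝ} {α : ℝ≥0}

theorem holderOnWith_of_dist_le {X Y : Type*} [PseudoMetricSpace X] [PseudoMetricSpace Y]
    {C r : ℝ≥0} {f : X → Y} {s : Set X}
    (h : ∀ x ∈ s, ∀ y ∈ s, dist (f x) (f y) ≤ C * dist x y ^ (r : ℝ)) : HolderOnWith C r f s := by
  intro x hx y hy
  have := ENNReal.ofReal_le_ofReal (h x hx y hy)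
  rwa [ENNReal.ofReal_mul C.coe_nonneg, ENNReal.ofReal_coe_nnreal,
    ← ENNReal.ofReal_rpow_of_nonneg dist_nonneg r.coe_nonneg, ← edist_dist, ← edist_dist] at this

/-- The preimage under the chart `φ` of the closed ball of radius `ε` about `φ z₀`. -/
def chartClosedBall (φ : OpenPartialHomeomorph M (Euc n)) (z₀ : M) (ε : ℝ) : Set M :=
  φ.source ∩ φ ⁻¹' Metric.closedBall (φ z₀) ε

theorem isCompact_chartClosedBall (h : Metric.closedBall (φ z₀) ε ⊆ φ.target) :
    IsCompact (chartClosedBall φ z₀ ε) := by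
  rw [chartClosedBall, ← φ.symm_image_eq_source_inter_preimage h]
  exact (isCompact_closedBall _ _).image_of_continuousOn (φ.continuousOn_symm.mono h)

theorem chartClosedBall_subset (hε : 0 < ε) : chartClosedBall φ z₀ (ε / 2) ⊆ chartBall φ z₀ ε :=
  inter_subset_inter_right _ (preimage_mono (Metric.closedBall_subset_ball (by linarith)))

/-- The factor by which the Hölder norm may grow under extension by zero from the ball of radius
`ε` of a function supported in the closed ball of half the radius. -/
noncomputable def extensionFactor (ε : ℝ) (α : ℝ≥0) : ℝ := max 1 ((2 / ε) ^ (α : ℝ))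

theorem extensionFactor_pos : 0 < extensionFactor ε α := zero_lt_one.trans_le (le_max_left _ _)

/-- A point of the closed half-ball and a point outside the ball are at chart distance at least `ε /
2`, so `(2 / ε * dist) ^ α ≥ 1` and the sup bound controls the difference. -/
theorem HolderBound.holderNormLE (hε : 0 < ε) {h : M → ℝ}
    (hK : ∀ z ∉ chartClosedBall φ z₀ (ε / 2), h z = 0) {B : ℝ} (hB0 : 0 ≤ B)
    (hB : HolderBound φ (chartBall φ z₀ ε) α B h) :
    HolderNormLE φ α (B * extensionFactor ε α).toNNReal h := by
  have h1 : B ≤ B * extensionFactor ε α := le_mul_of_one_le_right hB0 (le_max_left _ _)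
  have hnn : 0 ≤ B * extensionFactor ε α := hB0.trans h1
  have hout : ∀ z ∉ chartBall φ z₀ ε, h z = 0 := fun z hz =>
    hK z fun hz' => hz (chartClosedBall_subset hε hz')
  refine ⟨fun z => ?_, holderOnWith_of_dist_le fun x hx y hy => ?_⟩
  · rw [Real.coe_toNNReal _ hnn]
    by_cases hz : z ∈ chartBall φ z₀ ε
    · exact (hB.1 z hz).trans h1
    · rw [hout z hz]; simpa using hnn
  rw [Real.coe_toNNReal _ hnn]
  have hd0 : 0 ≤ dist x y ^ (α : ℝ) := Real.rpow_nonneg dist_nonneg _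
  have key : ∀ x ∈ φ.target, ∀ y ∈ φ.target, φ.symm x ∈ chartBall φ z₀ ε →
      φ.symm y ∉ chartBall φ z₀ ε → dist (h (φ.symm x)) (h (φ.symm y)) ≤
        B * extensionFactor ε α * dist x y ^ (α : ℝ) := fun x hx y hy hxS hyS => by
    have hd0 : 0 ≤ dist x y ^ (α : ℝ) := Real.rpow_nonneg dist_nonneg _
    rw [hout _ hyS, Real.dist_eq, sub_zero]
    by_cases hxK : φ.symm x ∈ chartClosedBall φ z₀ (ε / 2)
    · have hx1 : dist x (φ z₀) ≤ ε / 2 := by simpa [φ.right_inv hx] using hxK.2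
      have hy1 : ε ≤ dist y (φ z₀) := by
        by_contra hlt
        exact hyS ⟨φ.map_target hy, by simpa [φ.right_inv hy] using hlt⟩
      have hxy : ε / 2 ≤ dist x y := by
        have := dist_triangle y x (φ z₀)
        rw [dist_comm y x] at this
        linarith
      have h2 : 1 ≤ (2 / ε) ^ (α : ℝ) * dist x y ^ (α : ℝ) := by
        rw [← Real.mul_rpow (by positivity) dist_nonneg]
        refine Real.one_le_rpow ?_ α.coe_nonneg
        rw [div_mul_eq_mul_div, le_div_iff₀ hε]
        linarith
      calc |h (φ.symm x)| ≤ B * 1 := by rw [mul_one]; exact hB.1 _ hxS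
        _ ≤ B * (extensionFactor ε α * dist x y ^ (α : ℝ)) :=
          mul_le_mul_of_nonneg_left
            (h2.trans (mul_le_mul_of_nonneg_right (le_max_right _ _) hd0)) hB0
        _ = _ := by ring
    · rw [hK _ hxK, abs_zero]; positivity
  by_cases hxS : φ.symm x ∈ chartBall φ z₀ ε <;> by_cases hyS : φ.symm y ∈ chartBall φ z₀ ε
  · have := hB.2 _ hxS _ hyS
    rw [φ.right_inv hx, φ.right_inv hy] at this
    exact this.trans (mul_le_mul_of_nonneg_right h1 hd0)
  · exact key x hx y hy hxS hyS
  · rw [dist_comm, dist_comm x]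
    exact key y hy x hx hyS hxS
  · rw [hout _ hxS, hout _ hyS, dist_self]; positivity

theorem HolderBound.continuousAt (hα : 0 < α) {S : Set M} (hS : IsOpen S) (hSφ : S ⊆ φ.source)
    {h : M → ℝ} {B : ℝ} (hB : HolderBound φ S α B h) {z : M} (hz : z ∈ S) :
    ContinuousAt h z := by
  have h1 : Filter.Tendsto (fun w => B * dist (φ w) (φ z) ^ (α : ℝ)) (𝓝 z) (𝓝 0) := by
    have h2 : ContinuousAt (fun w => B * dist (φ w) (φ z) ^ (α : ℝ)) z :=
      continuousAt_const.mul (((φ.continuousAt (hSφ hz)).dist continuousAt_const).rpow_const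
        (Or.inr α.coe_nonneg))
    simpa [ContinuousAt, Real.zero_rpow (NNReal.coe_pos.2 hα).ne'] using h2
  refine tendsto_iff_dist_tendsto_zero.2 (squeeze_zero' (Filter.Eventually.of_forall
    fun _ => dist_nonneg) ?_ h1)
  filter_upwards [hS.mem_nhds hz] with w hw using hB.2 w hw z hz

theorem HolderBound.continuous (hα : 0 < α) {S K : Set M} (hS : IsOpen S) (hSφ : S ⊆ φ.source)
    (hK : IsClosed K) (hKS : K ⊆ S) {h : M → ℝ} (hz : ∀ z ∉ K, h z = 0) {B : ℝ}
    (hB : HolderBound φ S α B h) : Continuous h := by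
  refine continuous_iff_continuousAt.2 fun z => ?_
  by_cases hzK : z ∈ K
  · exact hB.continuousAt hα hS hSφ (hKS hzK)
  · refine continuousAt_const.congr (f := fun _ => (0 : ℝ)) ?_
    filter_upwards [hK.isOpen_compl.mem_nhds hzK] with w hw using (hz w hw).symm

variable [T2Space M]

theorem mem_holderSpace (hε : 0 < ε) (hball : Metric.closedBall (φ z₀) ε ⊆ φ.target)
    {U : Set M} (hU : chartBall φ z₀ ε ⊆ U) {h : M → ℝ}
    (hK : ∀ z ∉ chartClosedBall φ z₀ (ε / 2), h z = 0)
    (hB : ∃ B, 0 ≤ B ∧ HolderBound φ (chartBall φ z₀ ε) α B h) : h ∈ holderSpace φ U α := by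
  have hcpt : IsCompact (chartClosedBall φ z₀ (ε / 2)) :=
    isCompact_chartClosedBall ((Metric.closedBall_subset_closedBall (by linarith)).trans hball)
  obtain ⟨B, hB0, hB⟩ := hB
  exact ⟨HasCompactSupport.intro hcpt fun z hz => hK z hz,
    (closure_minimal (Function.support_subset_iff'.2 hK) hcpt.isClosed).trans
      ((chartClosedBall_subset hε).trans hU), _, hB.holderNormLE hε hK hB0⟩

omit [T2Space M] in
theorem LeafClass.leafDerivs {ι : Type*} {ψ : M → Euc n} {S : Set M} {a : ℝ} {k : ℕ}
    (js : List (Fin q)) {f : ι → M → ℝ} (hf : LeafClass Γ ψ S a (js.length + k) f) :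
    LeafClass Γ ψ S a k fun i => leafDerivs Γ js (f i) := by
  induction js using List.reverseRecOn generalizing f with
  | nil => simpa [LeafRegularity.leafDerivs] using hf
  | append_singleton js j ih =>
    rw [List.length_append, List.length_singleton, Nat.add_right_comm] at hf
    simpa [LeafRegularity.leafDerivs] using ih (hf.2.2 j)

omit [T2Space M] in
theorem leafDerivs_eq_zero {K : Set M} (hK : IsClosed K) {f : M → ℝ} (hf : ∀ z ∉ K, f z = 0)
    (js : List (Fin q)) : ∀ z ∉ K, leafDerivs Γ js f z = 0 := by
  induction js with
  | nil => exact hf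
  | cons j js ih => exact leafDeriv_eq_zero hK ih j

theorem mem_leafHolderSpace (hε : 0 < ε) (hball : Metric.closedBall (φ z₀) ε ⊆ φ.target)
    (hU : chartBall φ z₀ ε ⊆ Γ.target) {h : M → ℝ}
    (hK : ∀ z ∉ chartClosedBall φ z₀ (ε / 2), h z = 0) {m : ℕ}
    (hL : LeafClass Γ φ (chartBall φ z₀ ε) α m fun _ : Unit => h) :
    h ∈ leafHolderSpace Γ φ α m := by
  have hcl : IsClosed (chartClosedBall φ z₀ (ε / 2)) :=
    (isCompact_chartClosedBall
      ((Metric.closedBall_subset_closedBall (by linarith)).trans hball)).isClosed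
  refine ⟨fun js hjs => ?_, fun js hjs w hw => ?_⟩
  · have hL' := LeafClass.leafDerivs js (k := m - js.length) (by rwa [Nat.add_sub_cancel' hjs])
    obtain ⟨B, hB0, hB⟩ := hL'.holderBound
    have hUφ : chartBall φ z₀ ε ⊆ Γ.target ∩ φ.source := fun z hz => ⟨hU hz, hz.1⟩
    exact mem_holderSpace hε hball hUφ (leafDerivs_eq_zero hcl hK js)
      ⟨B, hB0, hB ()⟩
  · by_cases hwS : Γ w ∈ chartBall φ z₀ ε
    · have hL' := LeafClass.leafDerivs js (k := m - js.length - 1 + 1)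
        (by rwa [show js.length + (m - js.length - 1 + 1) = m by omega])
      simpa [plaque, Γ.left_inv hw] using hL'.2.1 () _ hwS
    · have hwK : Γ w ∉ chartClosedBall φ z₀ (ε / 2) := fun h' =>
        hwS (chartClosedBall_subset hε h')
      have hc : ContinuousAt (fun y => Γ (w.1, y)) w.2 :=
        ContinuousAt.comp (f := fun y => (w.1, y)) (Γ.continuousAt hw) (by fun_prop)
      refine (differentiableAt_const (0 : ℝ)).congr_of_eventuallyEq ?_
      filter_upwards [hc (hcl.isOpen_compl.mem_nhds hwK)] with y hy
      exact leafDerivs_eq_zero hcl hK js _ hy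

variable {𝕜 : Type*} [RCLike 𝕜]

omit [T2Space M] in
theorem distDerivs_replicate (j : Fin q) (m : ℕ) (D : (M → ℝ) → 𝕜) (h : M → ℝ) :
    distDerivs Γ (List.replicate m j) D h = (-1) ^ m * D ((leafDeriv Γ j)^[m] h) := by
  induction m generalizing h with
  | zero => simp [distDerivs]
  | succ m ih =>
    have : distDerivs Γ (List.replicate (m + 1) j) D h =
      -distDerivs Γ (List.replicate m j) D (leafDeriv Γ j h) := rfl
    rw [this, ih, Function.iterate_succ_apply, pow_succ]
    ring

/-- All test functions are supported in one compact set, the closed half-ball, so one continuity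
constant serves them all; extension by zero costs `extensionFactor`. -/
theorem ExtendsToHolderDual.exists_bound {j : Fin q} {m : ℕ} {D : (M → ℝ) → 𝕜}
    (hD : ExtendsToHolderDual Γ φ α m (distDerivs Γ (List.replicate m j) D))
    (hε : 0 < ε) (hball : Metric.closedBall (φ z₀) ε ⊆ φ.target)
    (hU : chartBall φ z₀ ε ⊆ Γ.target) :
    ∃ C, ∀ f : M → ℝ, (∀ z ∉ chartClosedBall φ z₀ (ε / 2), f z = 0) →
      LeafClass Γ φ (chartBall φ z₀ ε) α m (fun _ : Unit => f) → ∀ B, 0 ≤ B →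
      HolderBound φ (chartBall φ z₀ ε) α B f → ‖D ((leafDeriv Γ j)^[m] f)‖ ≤ C * B := by
  obtain ⟨T, hT, hTD⟩ := hD
  have hcpt : IsCompact (chartClosedBall φ z₀ (ε / 2)) :=
    isCompact_chartClosedBall ((Metric.closedBall_subset_closedBall (by linarith)).trans hball)
  have hUφ : chartBall φ z₀ ε ⊆ Γ.target ∩ φ.source := fun z hz => ⟨hU hz, hz.1⟩
  obtain ⟨C, hC⟩ := hT _ hcpt ((chartClosedBall_subset hε).trans hUφ)
  refine ⟨C * extensionFactor ε α, fun f hf hL B hB0 hB => ?_⟩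
  have hmem := mem_holderSpace hε hball hUφ hf ⟨B, hB0, hB⟩
  have h1 := hC ⟨f, hmem⟩
    (closure_minimal (Function.support_subset_iff'.2 hf) hcpt.isClosed) _
    (hB.holderNormLE hε hf hB0)
  rw [hTD ⟨f, hmem⟩ (mem_leafHolderSpace hε hball hU hf hL), distDerivs_replicate, norm_mul,
    norm_pow, norm_neg, norm_one, one_pow, one_mul,
    Real.coe_toNNReal _ (mul_nonneg hB0 extensionFactor_pos.le)] at h1
  exact h1.trans (le_of_eq (by ring))

theorem integrable_mul_of_holderBound [MeasurableSpace M] [BorelSpace M] {μ : Measure M}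
    {u : M → 𝕜} (hu : Integrable u μ) (hα : 0 < α) (hε : 0 < ε)
    (hball : Metric.closedBall (φ z₀) ε ⊆ φ.target) {f : M → ℝ}
    (hf : ∀ z ∉ chartClosedBall φ z₀ (ε / 2), f z = 0)
    (hB : ∃ B, HolderBound φ (chartBall φ z₀ ε) α B f) :
    Integrable (fun z => (f z : 𝕜) * u z) μ := by
  have hcpt : IsCompact (chartClosedBall φ z₀ (ε / 2)) :=
    isCompact_chartClosedBall ((Metric.closedBall_subset_closedBall (by linarith)).trans hball)
  obtain ⟨B, hB⟩ := hB
  have hc : Continuous f := hB.continuous hα (isOpen_chartBall _ _ _) inter_subset_left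
    hcpt.isClosed (chartClosedBall_subset hε) hf
  refine hu.bdd_mul (c := max B 0) (RCLike.continuous_ofReal.comp hc).aestronglyMeasurable
    (Filter.Eventually.of_forall fun z => ?_)
  rw [RCLike.norm_ofReal]
  by_cases hz : z ∈ chartBall φ z₀ ε
  · exact (hB.1 z hz).trans (le_max_left _ _)
  · rw [hf z fun h => hz (chartClosedBall_subset hε h), abs_zero]
    exact le_max_right _ _

end Dual

/-! ### Decay of the localized oscillatory integrals. -/

section OscillatoryDecay

variable {n p q : ℕ} {M : Type*} [TopologicalSpace M] [ChartedSpace (Euc n) M]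

/-- The first alternative is the default value of `mfderiv`; it is harmless, since zero lies in the
kernel of every covector. -/
theorem mfderiv_plaque_eq (Γ : OpenPartialHomeomorph (Euc p × Euc q) M) {z : M}
    (hz : z ∈ Γ.target) (v : Euc q) :
    (mfderiv 𝓘(ℝ, Euc q) 𝓘(ℝ, Euc n) (plaque Γ z) (Γ.symm z).2 v : Euc n) = 0 ∨
      (mfderiv 𝓘(ℝ, Euc q) 𝓘(ℝ, Euc n) (plaque Γ z) (Γ.symm z).2 v : Euc n) =
        fderiv ℝ (fun y => chartAt (Euc n) z (plaque Γ z y)) (Γ.symm z).2 v := by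
  by_cases hd : MDifferentiableAt 𝓘(ℝ, Euc q) 𝓘(ℝ, Euc n) (plaque Γ z) (Γ.symm z).2
  · right
    rw [hd.mfderiv]
    simp only [writtenInExtChartAt, mfld_simps, fderivWithin_univ]
    rw [plaque_self hz]
    rfl
  · left
    rw [mfderiv_zero_of_not_mdifferentiableAt hd]
    rfl

/-- Otherwise `ξ` would annihilate all leaf directions, hence their span, hence itself. The tangent
space at `z` is read in the preferred chart at `z`. -/
theorem HolderFoliation.exists_leafDeriv_inner_ne_zero {r : ℕ} (F : Fin r → HolderFoliation n M)
    {z : M} (hspan : ⨆ i, (F i).tangentSpace z = ⊤) {ξ : Euc n} (hξ : ξ ≠ 0) :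
    ∃ i, ∃ Γ ∈ (F i).charts, z ∈ Γ.target ∧ ∃ j,
      inner ℝ ξ (fderiv ℝ (fun y => chartAt (Euc n) z (plaque Γ z y)) (Γ.symm z).2
        (EuclideanSpace.single j 1)) ≠ 0 := by
  by_contra! hcon
  let ℓ : TangentSpace 𝓘(ℝ, Euc n) z →ₗ[ℝ] ℝ := (innerSL ℝ ξ : Euc n →L[ℝ] ℝ).toLinearMap
  have h1 : ⨆ i, (F i).tangentSpace z ≤ LinearMap.ker ℓ := by
    refine iSup_le fun i => iSup₂_le fun Γ hΓ => iSup_le fun hz => ?_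
    rintro _ ⟨v, rfl⟩
    have h2 : ∀ v, inner ℝ ξ (fderiv ℝ (fun y => chartAt (Euc n) z (plaque Γ z y)) (Γ.symm z).2 v)
        = 0 := fun v => by
      conv_lhs => rw [← (EuclideanSpace.basisFun (Fin (F i).dim) ℝ).sum_repr v]
      simp [inner_sum, inner_smul_right, hcon i Γ hΓ hz]
    rw [LinearMap.mem_ker]
    change inner ℝ ξ (mfderiv 𝓘(ℝ, Euc (F i).dim) 𝓘(ℝ, Euc n) (plaque Γ z) (Γ.symm z).2 v : Euc n)
      = 0
    rcases mfderiv_plaque_eq (n := n) Γ hz v with h | h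
    · exact (congrArg (fun w : Euc n => (inner ℝ ξ w : ℝ)) h).trans (inner_zero_right ξ)
    · exact (congrArg (fun w : Euc n => (inner ℝ ξ w : ℝ)) h).trans (h2 v)
  rw [hspan] at h1
  have h3 : ℓ ξ = 0 := LinearMap.mem_ker.1 (h1 Submodule.mem_top)
  exact hξ (inner_self_eq_zero.1 h3)

/-- The function of the coordinates `φ` given by `β`, extended by zero. -/
noncomputable def chartLift (φ : OpenPartialHomeomorph M (Euc n)) (β : Euc n → ℝ) : M → ℝ :=
  φ.source.indicator fun z => β (φ z)

variable [T2Space M] [MeasurableSpace M] [BorelSpace M] {𝕜 : Type*} [RCLike 𝕜]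
  {μ : Measure M} {u : M → 𝕜}

/-- Decay in the frequency directions `ξ` in `A`, to order `N`, of the localizations of `u` to
the ball of radius `ε / 2`. -/
def DecaysOn (μ : Measure M) (u : M → 𝕜) (φ : OpenPartialHomeomorph M (Euc n)) (z₀ : M) (N : ℕ)
    (ε : ℝ) (A : Set (Euc n)) : Prop :=
  ∀ β : Euc n → ℝ, ContDiff ℝ ∞ β → (∀ x ∉ Metric.closedBall (φ z₀) (ε / 2), β x = 0) →
    ∃ C : ℝ, ∀ ξ ∈ A, ‖ξ‖ ≤ 1 → ∀ l θ : ℝ, 1 ≤ l →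
      ‖∫ z, ((chartLift φ β z * Real.cos (l * inner ℝ ξ (φ z) + θ) : ℝ) : 𝕜) * u z ∂μ‖
        ≤ C * l / l ^ N

theorem exists_nhds_eventually_decaysOn (hu : Integrable u μ)
    {Γ : OpenPartialHomeomorph (Euc p × Euc q) M} (hΓ : IsHolderFoliationChart n Γ)
    {φ : OpenPartialHomeomorph M (Euc n)} (hφ : φ ∈ atlas (Euc n) M)
    (hD : ∀ js : List (Fin q), ∀ α : ℝ≥0, 0 < α → α ≤ 1 → ExtendsToHolderDual Γ φ α js.length
      (distDerivs Γ js fun h : M → ℝ => ∫ z, (h z : 𝕜) * u z ∂μ))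
    {z₀ : M} (hz₀ : z₀ ∈ Γ.target ∩ φ.source) {ξ₀ : Euc n} {j : Fin q}
    (hξ₀ : inner ℝ ξ₀ (fderiv ℝ (fun y => φ (plaque Γ z₀ y)) (Γ.symm z₀).2
        (EuclideanSpace.single j 1)) ≠ 0) (N : ℕ) :
    ∃ A ∈ 𝓝 ξ₀, ∀ᶠ ε in 𝓝[>] (0 : ℝ), DecaysOn μ u φ z₀ N ε A := by
  -- Order `N + 1`, because `V_j ψ` itself must have `N` leafwise derivatives. The exponent is fixed
  -- before the radius.
  obtain ⟨a, hcoord, ha0, ha1⟩ := ((eventually_leafClass_coord hΓ hφ hz₀ (N + 1)).and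
    (Ioo_mem_nhdsGT one_pos)).exists
  lift a to ℝ≥0 using ha0.le
  have hsub := eventually_chartBall_subset hz₀.2 ((Γ.open_target.inter φ.open_source).mem_nhds hz₀)
  have hdiff : ∀ {ε : ℝ}, (∀ l, LeafClass Γ φ (chartBall φ z₀ ε) a (N + 1)
      fun (_ : Unit) z => φ z l) → LeafDifferentiableOn Γ (chartBall φ z₀ ε) φ :=
    fun h z hz => differentiableAt_euclidean.2 fun l => (h l).2.1 () z hz
  -- the derivative of the phase is bounded below near `(ξ₀, z₀)`
  have hlower : ∃ c > 0, ∀ᶠ w : Euc n × M in 𝓝 ξ₀ ×ˢ 𝓝 z₀,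
      c ≤ |∑ l, w.1 l * leafDeriv Γ j (fun z => φ z l) w.2| := by
    obtain ⟨ε, ⟨hε, hεsub⟩, hε0⟩ := ((hcoord.and hsub).and self_mem_nhdsWithin).exists
    have hSΓ : chartBall φ z₀ ε ⊆ Γ.target := hεsub.trans inter_subset_left
    have hmem : z₀ ∈ chartBall φ z₀ ε := mem_chartBall_self hz₀.2 hε0
    have hne : ∑ l, ξ₀ l * leafDeriv Γ j (fun z => φ z l) z₀ ≠ 0 := by
      simp only [leafDeriv_coord hSΓ (hdiff hε) hmem]
      simpa [PiLp.inner_apply, mul_comm] using hξ₀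
    have hc : ContinuousAt (fun w : Euc n × M =>
        |∑ l, w.1 l * leafDeriv Γ j (fun z => φ z l) w.2|) (ξ₀, z₀) := by
      refine ContinuousAt.abs (tendsto_finsetSum _ fun l _ => ?_)
      obtain ⟨C, -, hC⟩ := ((hε l).2.2 j).holderBound
      have h1 : ContinuousAt (leafDeriv Γ j fun z => φ z l) z₀ :=
        (hC ()).continuousAt (by exact_mod_cast ha0) (isOpen_chartBall _ _ _) inter_subset_left hmem
      exact ContinuousAt.mul (by fun_prop)
        (ContinuousAt.comp (g := leafDeriv Γ j fun z => φ z l) (f := Prod.snd) (x := (ξ₀, z₀)) h1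
          continuousAt_snd)
    refine ⟨|∑ l, ξ₀ l * leafDeriv Γ j (fun z => φ z l) z₀| / 2, by positivity, ?_⟩
    rw [← nhds_prod_eq]
    exact hc.eventually (eventually_ge_nhds (half_lt_self (abs_pos.2 hne)))
  obtain ⟨c, hc, hlow⟩ := hlower
  obtain ⟨A, hA, O, hO, hAO⟩ := Filter.mem_prod_iff.1 hlow
  refine ⟨A, hA, ?_⟩
  filter_upwards [hcoord, hsub, eventually_chartBall_subset hz₀.2 hO, self_mem_nhdsWithin,
    Ioo_mem_nhdsGT (show (0 : ℝ) < 1 / 2 by norm_num), eventually_closedBall_subset_target hz₀.2]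
    with ε hε hεsub hεO hε0 hε2 hball β hβ hβ0
  have hSΓ : chartBall φ z₀ ε ⊆ Γ.target := hεsub.trans inter_subset_left
  have hS := isOpen_chartBall φ z₀ ε
  have hφS : ∀ z ∈ chartBall φ z₀ ε, φ z ∈ Metric.ball (φ z₀) ε := fun z hz => hz.2
  have hcl : IsClosed (chartClosedBall φ z₀ (ε / 2)) := (isCompact_chartClosedBall
    ((Metric.closedBall_subset_closedBall (by linarith [hε2.1])).trans hball)).isClosed
  have hsmooth : ∀ γ : Euc n → ℝ, ContDiff ℝ ∞ γ → LeafClass Γ φ (chartBall φ z₀ ε) a (N + 1)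
      fun (_ : Unit) z => γ (φ z) := fun γ hγ =>
    LeafClass.smooth_comp hS hSΓ hε2.2.le ha1.le hφS hε hγ
  have hinner : ∀ ξ : Euc n, ContDiff ℝ ∞ fun x => inner ℝ ξ x := fun ξ =>
    contDiff_const.inner ℝ contDiff_id
  -- Taking the directions `ξ` as index set makes the constant independent of `ξ`.
  refine Exists.imp (fun C hC ξ hξ hξ1 l θ hl => hC ⟨ξ, hξ, hξ1⟩ l θ hl)
    (exists_decay (ι := {ξ : Euc n // ξ ∈ A ∧ ‖ξ‖ ≤ 1}) (j := j) (N := N)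
    (D := fun h : M → ℝ => ∫ z, (h z : 𝕜) * u z ∂μ) (α := (a : ℝ)) (φ := φ)
    (ψ := fun ξ z => inner ℝ ξ.1 (φ z)) (c := c) hS hSΓ hcl (chartClosedBall_subset hε0)
    (fun f g hf hg hfB hgB t => ?_)
    (fun m _ => ExtendsToHolderDual.exists_bound (by
      simpa using hD (List.replicate m j) a (by exact_mod_cast ha0) (by exact_mod_cast ha1.le))
      hε0 hball hSΓ) hc
    (fun ξ z hz z' hz' => ?_) (fun ξ => (hsmooth _ (hinner ξ)).2.1 ())
    (fun ξ z hz => ?_) ?_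
    (fun ξ l θ => (hsmooth (fun x => Real.cos (l * inner ℝ ξ.1 x + θ)) ?_).of_succ) N 0 (by omega)
    (fun _ => chartLift φ β) (fun _ z hz => ?_) ?_)
  · have hfi := integrable_mul_of_holderBound hu (by exact_mod_cast ha0) hε0 hball hf hfB
    have hgi := integrable_mul_of_holderBound hu (by exact_mod_cast ha0) hε0 hball hg hgB
    simp only
    rw [← integral_sub hfi hgi, ← integral_const_mul]
    congr 1 with z
    push_cast
    ring
  -- `‖ξ‖ ≤ 1` makes the phase `1`-Lipschitz in `φ`, hence `α`-Hölder with constant `1` at distances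
  -- at most `1`.
  · have hd : dist (φ z) (φ z') ≤ 1 := by
      have h1 := dist_triangle_right (φ z) (φ z') (φ z₀)
      have h2 : dist (φ z) (φ z₀) < ε := hz.2
      have h3 : dist (φ z') (φ z₀) < ε := hz'.2
      linarith [hε2.2]
    rw [← inner_sub_right]
    refine (abs_real_inner_le_norm _ _).trans (le_trans ?_
      (le_rpow_of_le_one dist_nonneg hd ha1.le))
    rw [dist_eq_norm]
    exact mul_le_of_le_one_left (norm_nonneg _) ξ.2.2
  · rw [leafDeriv_inner hSΓ (hdiff hε) hz]
    exact hAO (mk_mem_prod ξ.2.1 (hεO hz))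
  · refine (LeafClass.sum hS hSΓ Finset.univ fun l => LeafClass.const_mul hS hSΓ (C := 1)
      (c := fun ξ : {ξ : Euc n // ξ ∈ A ∧ ‖ξ‖ ≤ 1} => ξ.1 l)
      (fun ξ => (PiLp.norm_apply_le ξ.1 l).trans ξ.2.2)
      (((hε l).2.2 j).comp_index fun _ => ())).congr hS hSΓ fun ξ z hz =>
        leafDeriv_inner hSΓ (hdiff hε) hz j ξ.1
  · exact Real.contDiff_cos.comp ((contDiff_const.mul (hinner ξ)).add contDiff_const)
  · by_cases hz' : z ∈ φ.source
    · rw [chartLift, indicator_of_mem hz']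
      exact hβ0 _ fun h => hz ⟨hz', h⟩
    · exact indicator_of_notMem hz' _
  · rw [Nat.zero_add]
    exact (((hsmooth β hβ).of_succ).comp_index fun _ => ()).congr hS hSΓ fun _ z hz =>
      indicator_of_mem hz.1 _

/-- The neighbourhood of a direction does not depend on `ε`: finitely many cover the sphere, and
their smallness conditions on `ε` combine. -/
theorem eventually_decaysOn_sphere (hu : Integrable u μ) {r : ℕ} (F : Fin r → HolderFoliation n M)
    (z₀ : M) (hspan : ⨆ i, (F i).tangentSpace z₀ = ⊤)
    (hD : ∀ i, (F i).DerivsDualToHolder (fun h : M → ℝ => ∫ z, (h z : 𝕜) * u z ∂μ)) (N : ℕ) :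
    ∀ᶠ ε in 𝓝[>] (0 : ℝ),
      DecaysOn μ u (chartAt (Euc n) z₀) z₀ N ε (Metric.sphere (0 : Euc n) 1) := by
  refine (isCompact_sphere (0 : Euc n) 1).induction_on (p := fun A => ∀ᶠ ε in 𝓝[>] (0 : ℝ),
      DecaysOn μ u (chartAt (Euc n) z₀) z₀ N ε A) ?_ ?_ ?_ ?_
  · exact Filter.Eventually.of_forall fun ε β _ _ => ⟨0, by simp⟩
  · exact fun A B hAB h => h.mono fun ε h β hβ hβ0 =>
      (h β hβ hβ0).imp fun C hC ξ hξ => hC ξ (hAB hξ)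
  · intro A B hA hB
    filter_upwards [hA, hB] with ε hA hB β hβ hβ0
    obtain ⟨C₁, h₁⟩ := hA β hβ hβ0
    obtain ⟨C₂, h₂⟩ := hB β hβ hβ0
    refine ⟨max C₁ C₂, fun ξ hξ hξ1 l θ hl => ?_⟩
    have hl0 : 0 < l := one_pos.trans_le hl
    rcases hξ with h | h
    · refine (h₁ ξ h hξ1 l θ hl).trans ?_
      gcongr
      exact le_max_left _ _
    · refine (h₂ ξ h hξ1 l θ hl).trans ?_
      gcongr
      exact le_max_right _ _
  · intro ξ hξ
    have hξ0 : ξ ≠ 0 := by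
      rintro rfl
      simp at hξ
    obtain ⟨i, Γ, hΓ, hz, j, hj⟩ := HolderFoliation.exists_leafDeriv_inner_ne_zero F hspan hξ0
    obtain ⟨A, hA, h⟩ := exists_nhds_eventually_decaysOn hu ((F i).isChart Γ hΓ)
      (chart_mem_atlas (Euc n) z₀) (hD i Γ hΓ _ (chart_mem_atlas (Euc n) z₀))
      ⟨hz, mem_chart_source _ _⟩ hj N
    exact ⟨A, mem_nhdsWithin_of_mem_nhds hA, h⟩

end OscillatoryDecay

/-! ### Fourier inversion and regularity from decay. -/

section FourierInversion

open FourierTransform SchwartzMap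

variable {V : Type*} [NormedAddCommGroup V] [InnerProductSpace ℝ V] [FiniteDimensional ℝ V]
  [MeasurableSpace V] [BorelSpace V]

theorem integral_fourier_mul {f g : V → ℂ} (hf : Integrable f) (hg : Integrable g) :
    ∫ ξ, 𝓕 f ξ * g ξ = ∫ x, f x * 𝓕 g x := by
  simpa using! VectorFourier.integral_bilin_fourierIntegral_eq_flip (.mul ℂ ℂ) (L := innerₗ V)
    Real.continuous_fourierChar continuous_inner hf hg

theorem continuous_fourier {f : V → ℂ} (hf : Integrable f) : Continuous (𝓕 f) :=
  VectorFourier.fourierIntegral_continuous Real.continuous_fourierChar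
    (L := innerₗ V) continuous_inner hf

/-- Fourier inversion almost everywhere. -/
theorem ae_eq_fourierInv_fourier {f : V → ℂ} (hf : Integrable f) (hf' : Integrable (𝓕 f)) :
    f =ᵐ[volume] 𝓕⁻ (𝓕 f) := by
  have hneg : Integrable fun x => 𝓕 f (-x) := hf'.comp_neg
  have hc : Continuous (𝓕⁻ (𝓕 f)) := by
    rw [Real.fourierInv_eq_fourier_comp_neg]
    exact continuous_fourier hneg
  -- As `f` is merely integrable, it is tested against `g = 𝓕 (𝓕⁻ g)`, and the transforms are moved
  -- across by self-adjointness, twice.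
  refine ae_eq_of_integral_contDiff_smul_eq hf.locallyIntegrable hc.locallyIntegrable
    fun g hg hgc => ?_
  have hg2 : ContDiff ℝ ∞ fun x => (g x : ℂ) := Complex.ofRealCLM.contDiff.comp hg
  have hgc2 : HasCompactSupport fun x => (g x : ℂ) := hgc.comp_left Complex.ofReal_zero
  let γ : 𝓢(V, ℂ) := hgc2.toSchwartzMap hg2
  have hγ : ∀ x, γ x = (g x : ℂ) := fun x => rfl
  have e1 : 𝓕 ((𝓕⁻ γ : 𝓢(V, ℂ)) : V → ℂ) = (γ : V → ℂ) := by
    rw [← fourier_coe, FourierTransform.fourier_fourierInv_eq]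
  calc ∫ x, g x • f x = ∫ x, 𝓕 ((𝓕⁻ γ : 𝓢(V, ℂ)) : V → ℂ) x * f x := by
        rw [e1]; rfl
    _ = ∫ x, (𝓕⁻ γ : 𝓢(V, ℂ)) x * 𝓕 f x := integral_fourier_mul (𝓕⁻ γ).integrable hf
    _ = ∫ x, 𝓕 (γ : V → ℂ) (-x) * 𝓕 f x := by
        simp_rw [← Real.fourierInv_eq_fourier_neg, ← fourierInv_coe]
    _ = ∫ x, 𝓕 (γ : V → ℂ) x * 𝓕 f (-x) := by
        rw [← integral_neg_eq_self]
        simp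
    _ = ∫ x, γ x * 𝓕 (fun x => 𝓕 f (-x)) x := integral_fourier_mul γ.integrable hneg
    _ = ∫ x, g x • 𝓕⁻ (𝓕 f) x := by
        rw [Real.fourierInv_eq_fourier_comp_neg]; rfl

/-- As `cos (t + π / 2) = -sin t`, the shifts `0` and `π / 2` give the real and imaginary parts;
hence the free `θ` in the decay estimates. -/
theorem fourier_ofReal {g : V → ℝ} (hg : Integrable g) (ξ : V) :
    𝓕 (fun x => (g x : ℂ)) ξ =
      ((∫ x, g x * Real.cos (inner ℝ ((2 * Real.pi) • ξ) x + 0) : ℝ) : ℂ) +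
      ((∫ x, g x * Real.cos (inner ℝ ((2 * Real.pi) • ξ) x + Real.pi / 2) : ℝ) : ℂ) *
        Complex.I := by
  have hb : ∀ θ : ℝ, Integrable fun x => g x * Real.cos (inner ℝ ((2 * Real.pi) • ξ) x + θ) :=
    fun θ => by
      refine hg.mul_bdd (c := 1) (Continuous.aestronglyMeasurable (by fun_prop)) ?_
      exact Filter.Eventually.of_forall fun x => Real.abs_cos_le_one _
  rw [Real.fourier_eq', ← integral_complex_ofReal, ← integral_complex_ofReal,
    ← integral_mul_const, ← integral_add (hb 0).ofReal ((hb _).ofReal.mul_const _)]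
  congr 1 with x
  rw [real_inner_smul_left, real_inner_comm, add_zero, Real.cos_add_pi_div_two, Complex.exp_mul_I,
    ← Complex.ofReal_cos, ← Complex.ofReal_sin, show -2 * Real.pi * inner ℝ ξ x =
      -(2 * Real.pi * inner ℝ ξ x) by ring, Real.cos_neg, Real.sin_neg]
  simp only [smul_eq_mul]
  push_cast
  ring

/-- For `‖ξ‖ ≥ 1` use the hypothesis at `2πξ`, of norm `s` with `1 + ‖ξ‖ ≤ 2s`; below that the `L¹`
norm suffices. The numerator `‖ξ‖` uses up one of the `m + 1` powers. -/
theorem norm_fourier_le_of_decay {g : V → ℝ} (hg : Integrable g) {m : ℕ} {C : ℝ}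
    (hC : ∀ ξ : V, 1 ≤ ‖ξ‖ → ∀ θ : ℝ,
      |∫ x, g x * Real.cos (inner ℝ ξ x + θ)| ≤ C * ‖ξ‖ / ‖ξ‖ ^ (m + 1)) :
    ∃ C', ∀ ξ, ‖𝓕 (fun x => (g x : ℂ)) ξ‖ ≤ C' * ((1 + ‖ξ‖) ^ m)⁻¹ := by
  set I := ∫ x, ‖(g x : ℂ)‖ with hI
  have hI0 : 0 ≤ I := integral_nonneg fun _ => norm_nonneg _
  have hL1 : ∀ ξ, ‖𝓕 (fun x => (g x : ℂ)) ξ‖ ≤ I := fun ξ =>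
    VectorFourier.norm_fourierIntegral_le_integral_norm _ _ _ _ _
  refine ⟨2 ^ m * (2 * |C| + I), fun ξ => ?_⟩
  have hpos : 0 < (1 + ‖ξ‖) ^ m := by positivity
  rw [← div_eq_mul_inv, le_div_iff₀ hpos]
  rcases le_or_gt 1 ‖ξ‖ with h1 | h1
  · have hpi : 1 ≤ 2 * Real.pi := by linarith [Real.pi_gt_three]
    have hη : ‖ξ‖ ≤ ‖(2 * Real.pi) • ξ‖ := by
      rw [norm_smul, Real.norm_of_nonneg (by positivity)]
      exact le_mul_of_one_le_left (norm_nonneg _) hpi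
    have hc := hC ((2 * Real.pi) • ξ) (h1.trans hη)
    have hf := fourier_ofReal hg ξ
    generalize ‖(2 * Real.pi) • ξ‖ = s at hη hc
    have hs0 : 0 < s := one_pos.trans_le (h1.trans hη)
    have hsC : C * s / s ^ (m + 1) ≤ |C| / s ^ m := by
      rw [pow_succ, mul_div_mul_right _ _ hs0.ne']
      gcongr
      exact le_abs_self C
    have h2 : ‖𝓕 (fun x => (g x : ℂ)) ξ‖ ≤ 2 * (|C| / s ^ m) := by
      rw [hf]
      refine (norm_add_le _ _).trans ?_
      rw [norm_mul, Complex.norm_I, mul_one, Complex.norm_real, Complex.norm_real, Real.norm_eq_abs,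
        Real.norm_eq_abs, two_mul (|C| / s ^ m)]
      exact add_le_add ((hc 0).trans hsC) ((hc (Real.pi / 2)).trans hsC)
    calc ‖𝓕 (fun x => (g x : ℂ)) ξ‖ * (1 + ‖ξ‖) ^ m
        ≤ 2 * (|C| / s ^ m) * (2 * s) ^ m :=
          mul_le_mul h2 (pow_le_pow_left₀ (by positivity) (by linarith) m) hpos.le (by positivity)
      _ = 2 ^ m * (2 * |C|) := by
          rw [mul_pow]; field_simp
      _ ≤ _ := mul_le_mul_of_nonneg_left (by linarith) (by positivity)
  · calc ‖𝓕 (fun x => (g x : ℂ)) ξ‖ * (1 + ‖ξ‖) ^ m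
        ≤ I * 2 ^ m :=
          mul_le_mul (hL1 ξ) (pow_le_pow_left₀ (by positivity) (by linarith) m) hpos.le hI0
      _ ≤ _ := by
          rw [mul_comm]
          exact mul_le_mul_of_nonneg_left (by linarith [abs_nonneg C]) (by positivity)

/-- `k` powers absorb the weight, and the remaining `dim V + 1` make the bound integrable. -/
theorem integrable_pow_mul_norm_of_decay {F : V → ℂ} (hF : Continuous F) {k m : ℕ} (hm : m ≤ k)
    {C : ℝ}
    (hC : ∀ ξ, ‖F ξ‖ ≤ C * ((1 + ‖ξ‖) ^ (k + (Module.finrank ℝ V + 1)))⁻¹) :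
    Integrable fun ξ => ‖ξ‖ ^ m * ‖F ξ‖ := by
  have hb : Integrable fun ξ : V => C * (1 + ‖ξ‖) ^ (-((Module.finrank ℝ V + 1 : ℕ) : ℝ)) :=
    (integrable_one_add_norm (by exact_mod_cast Nat.lt_succ_self _)).const_mul C
  refine hb.mono' (by fun_prop) (Filter.Eventually.of_forall fun ξ => ?_)
  rw [Real.norm_of_nonneg (by positivity), Real.rpow_neg (by positivity), Real.rpow_natCast]
  have hp : 1 ≤ 1 + ‖ξ‖ := by linarith [norm_nonneg ξ]
  have hp0 : 0 < 1 + ‖ξ‖ := one_pos.trans_le hp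
  calc ‖ξ‖ ^ m * ‖F ξ‖
      ≤ (1 + ‖ξ‖) ^ k * (C * ((1 + ‖ξ‖) ^ (k + (Module.finrank ℝ V + 1)))⁻¹) :=
        mul_le_mul ((pow_le_pow_left₀ (norm_nonneg _) (by linarith) m).trans
          (pow_le_pow_right₀ hp hm)) (hC ξ) (norm_nonneg _) (by positivity)
    _ = C * ((1 + ‖ξ‖) ^ (Module.finrank ℝ V + 1))⁻¹ := by
        rw [pow_add _ k, mul_inv]
        field_simp

/-- A real integrable function with rapidly decaying Fourier integrals has a `C^k` version. -/
theorem exists_contDiff_ae_eq {g : V → ℝ} (hg : Integrable g) {k : ℕ} {C : ℝ}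
    (hC : ∀ ξ : V, 1 ≤ ‖ξ‖ → ∀ θ : ℝ, |∫ x, g x * Real.cos (inner ℝ ξ x + θ)| ≤
      C * ‖ξ‖ / ‖ξ‖ ^ (k + (Module.finrank ℝ V + 1) + 1)) :
    ∃ w : V → ℝ, ContDiff ℝ k w ∧ g =ᵐ[volume] w := by
  obtain ⟨C', hdecay⟩ := norm_fourier_le_of_decay hg hC
  set G : V → ℂ := fun x => (g x : ℂ) with hG
  have hGi : Integrable G := hg.ofReal
  have hcont : Continuous (𝓕 G) := continuous_fourier hGi
  have hint : ∀ m ≤ k, Integrable fun ξ => ‖ξ‖ ^ m * ‖𝓕 G ξ‖ := fun m hm =>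
    integrable_pow_mul_norm_of_decay hcont hm hdecay
  have hF : Integrable (𝓕 G) := by
    have := hint 0 (Nat.zero_le _)
    simp only [pow_zero, one_mul] at this
    exact (integrable_norm_iff hcont.aestronglyMeasurable).1 this
  have hsm : ContDiff ℝ k (𝓕⁻ (𝓕 G)) := by
    have h1 : ContDiff ℝ k (𝓕 (𝓕 G)) :=
      Real.contDiff_fourier (N := k) fun m hm => hint m (by exact_mod_cast hm)
    have h2 : 𝓕⁻ (𝓕 G) = fun x => 𝓕 (𝓕 G) (-x) := funext fun x =>
      Real.fourierInv_eq_fourier_neg _ x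
    rw [h2]
    exact h1.comp contDiff_neg
  refine ⟨fun x => (𝓕⁻ (𝓕 G) x).re, Complex.reCLM.contDiff.comp hsm, ?_⟩
  filter_upwards [ae_eq_fourierInv_fourier hGi hF] with x hx
  rw [← hx]
  rfl

end FourierInversion

/-! ### Versions of class `C^k` in charts, and gluing. -/

section Globalization

variable {𝕜 : Type*} [RCLike 𝕜]

/-- The cosine kernels are real, so the real and imaginary parts of `g` inherit the estimate. -/
theorem exists_contDiff_ae_eq_rclike {V : Type*} [NormedAddCommGroup V] [InnerProductSpace ℝ V]
    [FiniteDimensional ℝ V] [MeasurableSpace V] [BorelSpace V] {g : V → 𝕜} (hg : Integrable g)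
    {k : ℕ} {C : ℝ} (hC : ∀ ξ : V, 1 ≤ ‖ξ‖ → ∀ θ : ℝ,
      ‖∫ x, ((Real.cos (inner ℝ ξ x + θ) : ℝ) : 𝕜) * g x‖ ≤
      C * ‖ξ‖ / ‖ξ‖ ^ (k + (Module.finrank ℝ V + 1) + 1)) :
    ∃ w : V → 𝕜, ContDiff ℝ k w ∧ g =ᵐ[volume] w := by
  have hint : ∀ (ξ : V) (θ : ℝ),
      Integrable fun x => ((Real.cos (inner ℝ ξ x + θ) : ℝ) : 𝕜) * g x := fun ξ θ => by
    refine hg.bdd_mul (c := 1) (Continuous.aestronglyMeasurable (by fun_prop)) ?_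
    refine Filter.Eventually.of_forall fun x => ?_
    rw [RCLike.norm_ofReal]
    exact Real.abs_cos_le_one _
  have hpart : ∀ A : 𝕜 →L[ℝ] ℝ, (∀ x, |A x| ≤ ‖x‖) →
      ∃ w : V → ℝ, ContDiff ℝ k w ∧ (fun x => A (g x)) =ᵐ[volume] w := fun A hA => by
    refine exists_contDiff_ae_eq (A.integrable_comp hg) fun ξ hξ θ => le_trans ?_ (hC ξ hξ θ)
    refine le_trans (le_of_eq ?_) (hA _)
    rw [← A.integral_comp_comm (hint ξ θ)]
    congr 2 with x
    rw [← RCLike.real_smul_eq_coe_mul, map_smul, smul_eq_mul, mul_comm]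
  obtain ⟨w₁, hw₁, h₁⟩ := hpart RCLike.reCLM RCLike.abs_re_le_norm
  obtain ⟨w₂, hw₂, h₂⟩ := hpart RCLike.imCLM RCLike.abs_im_le_norm
  refine ⟨fun x => (w₁ x : 𝕜) + (w₂ x : 𝕜) * RCLike.I, ?_, ?_⟩
  · have hA : ContDiff ℝ k fun r : ℝ => (r : 𝕜) := (RCLike.ofRealCLM (K := 𝕜)).contDiff
    exact (hA.comp hw₁).add ((hA.comp hw₂).mul contDiff_const)
  · filter_upwards [h₁, h₂] with x hx₁ hx₂
    rw [← hx₁, ← hx₂]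
    exact (RCLike.re_add_im _).symm

variable {n : ℕ} {M : Type*} [TopologicalSpace M] [MeasurableSpace M] [BorelSpace M]
  {μ : Measure M} {φ : OpenPartialHomeomorph M (Euc n)} {ρ : Euc n → ℝ}

theorem aemeasurable_chart_symm (φ : OpenPartialHomeomorph M (Euc n)) (ρ : Euc n → ℝ) :
    AEMeasurable φ.symm
      ((volume.restrict φ.target).withDensity fun z => ENNReal.ofReal (ρ z)) :=
  (φ.continuousOn_symm.aemeasurable φ.open_target.measurableSet).mono_ac
    (withDensity_absolutelyContinuous _ _)

theorem map_chart_symm (hρ : (μ.restrict φ.source).map φ =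
      (volume.restrict φ.target).withDensity fun z => ENNReal.ofReal (ρ z)) :
    ((volume.restrict φ.target).withDensity fun z => ENNReal.ofReal (ρ z)).map φ.symm =
      μ.restrict φ.source := by
  have h := aemeasurable_chart_symm φ ρ
  have hφ : AEMeasurable φ (μ.restrict φ.source) :=
    φ.continuousOn.aemeasurable φ.open_source.measurableSet
  rw [← hρ] at h ⊢
  rw [AEMeasurable.map_map_of_aemeasurable h hφ]
  have : φ.symm ∘ φ =ᵐ[μ.restrict φ.source] id := by
    filter_upwards [ae_restrict_mem φ.open_source.measurableSet] with z hz using φ.left_inv hz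
  rw [Measure.map_congr this, Measure.map_id]

theorem chart_integral (hρc : ContinuousOn ρ φ.target) (hρ0 : ∀ z ∈ φ.target, 0 < ρ z)
    (hρ : (μ.restrict φ.source).map φ =
      (volume.restrict φ.target).withDensity fun z => ENNReal.ofReal (ρ z))
    {f : M → 𝕜} (hf : Integrable f μ) (hf0 : ∀ z ∉ φ.source, f z = 0) :
    Integrable (φ.target.indicator fun x => (ρ x : 𝕜) * f (φ.symm x)) ∧
      ∫ z, f z ∂μ = ∫ x, φ.target.indicator (fun x => (ρ x : 𝕜) * f (φ.symm x)) x := by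
  have hmap := map_chart_symm hρ
  have hmeas := aemeasurable_chart_symm φ ρ
  have hfr : Integrable f (μ.restrict φ.source) := hf.restrict
  have hfr' := hmap.symm ▸ hfr.aestronglyMeasurable
  have hρm : AEMeasurable (fun z => ENNReal.ofReal (ρ z)) (volume.restrict φ.target) :=
    (hρc.aemeasurable φ.open_target.measurableSet).ennreal_ofReal
  have hfin : ∀ᵐ z ∂volume.restrict φ.target, ENNReal.ofReal (ρ z) < ⊤ :=
    Filter.Eventually.of_forall fun z => ENNReal.ofReal_lt_top
  have hcongr : (fun x => (ENNReal.ofReal (ρ x)).toReal • f (φ.symm x))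
      =ᵐ[volume.restrict φ.target] fun x => (ρ x : 𝕜) * f (φ.symm x) := by
    filter_upwards [ae_restrict_mem φ.open_target.measurableSet] with x hx
    rw [ENNReal.toReal_ofReal (hρ0 x hx).le, RCLike.real_smul_eq_coe_mul]
  constructor
  · rw [← hmap, integrable_map_measure hfr' hmeas,
      integrable_withDensity_iff_integrable_smul₀' hρm hfin] at hfr
    rw [integrable_indicator_iff φ.open_target.measurableSet]
    exact hfr.congr hcongr
  · rw [← setIntegral_eq_integral_of_forall_compl_eq_zero (s := φ.source) (fun z hz => hf0 z hz),
      integral_indicator φ.open_target.measurableSet, ← integral_congr_ae hcongr,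
      ← integral_withDensity_eq_integral_toReal_smul₀ hρm hfin, ← hmap,
      integral_map hmeas hfr']

theorem aestronglyMeasurable_chartLift {γ : Euc n → ℝ} (hγ : Continuous γ) :
    AEStronglyMeasurable (chartLift φ γ) μ := by
  rw [chartLift, aestronglyMeasurable_indicator_iff φ.open_source.measurableSet]
  exact (hγ.comp_continuousOn φ.continuousOn).aestronglyMeasurable φ.open_source.measurableSet

variable [ChartedSpace (Euc n) M]

theorem IsSmoothVolume.isOpenPosMeasure (hμ : IsSmoothVolume (n := n) μ) :
    μ.IsOpenPosMeasure := by
  refine ⟨fun U hU ⟨z, hz⟩ h0 => ?_⟩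
  set φ := chartAt (Euc n) z
  obtain ⟨ρ, hρc, hρ0, hρ⟩ := hμ φ (chart_mem_atlas _ z)
  have hV : IsOpen (φ.target ∩ φ.symm ⁻¹' U) := φ.symm.isOpen_inter_preimage hU
  have hzV : φ z ∈ φ.target ∩ φ.symm ⁻¹' U :=
    ⟨mem_chart_target _ z, by rwa [mem_preimage, φ.left_inv (mem_chart_source _ z)]⟩
  have hφ : AEMeasurable φ (μ.restrict φ.source) :=
    φ.continuousOn.aemeasurable φ.open_source.measurableSet
  have h1 : ((μ.restrict φ.source).map φ) (φ.target ∩ φ.symm ⁻¹' U) = 0 := by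
    rw [Measure.map_apply_of_aemeasurable hφ hV.measurableSet,
      Measure.restrict_apply' φ.open_source.measurableSet]
    refine measure_mono_null (fun w hw => ?_) h0
    have := hw.1.2
    rwa [mem_preimage, φ.left_inv hw.2] at this
  have hρm : AEMeasurable (fun z => ENNReal.ofReal (ρ z)) (volume.restrict φ.target) :=
    (hρc.continuousOn.aemeasurable φ.open_target.measurableSet).ennreal_ofReal
  rw [hρ, withDensity_apply_eq_zero' hρm, Measure.restrict_apply' φ.open_target.measurableSet] at h1
  refine (hV.measure_pos volume ⟨_, hzV⟩).ne' (measure_mono_null (fun x hx => ?_) h1)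
  exact ⟨⟨by simpa using hρ0 x hx.1, hx⟩, hx.1⟩

variable {u : M → 𝕜}

theorem DecaysOn.exists_contMDiffOn [IsManifold 𝓘(ℝ, Euc n) ∞ M] (hμ : IsSmoothVolume (n := n) μ)
    (hu : Integrable u μ) {z₀ : M} {ε : ℝ} (hε : 0 < ε) {k : ℕ}
    (h : DecaysOn μ u (chartAt (Euc n) z₀) z₀ (k + (n + 1) + 1) ε (Metric.sphere 0 1)) :
    ∃ v : M → 𝕜, ContMDiffOn 𝓘(ℝ, Euc n) 𝓘(ℝ, 𝕜) k v (chartBall (chartAt (Euc n) z₀) z₀ (ε / 4)) ∧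
      ∀ᵐ z ∂μ, z ∈ chartBall (chartAt (Euc n) z₀) z₀ (ε / 4) → u z = v z := by
  set φ := chartAt (Euc n) z₀ with hφ
  obtain ⟨ρ, hρc, hρ0, hρ⟩ := hμ φ (chart_mem_atlas _ z₀)
  -- Equal to `1` on the ball of radius `ε / 4` and supported in that of radius `ε / 2`, as
  -- `DecaysOn` demands.
  let β : ContDiffBump (φ z₀) := ⟨ε / 4, ε / 2, by positivity, by linarith⟩
  obtain ⟨C, hC⟩ := h β β.contDiff fun x hx =>
    β.zero_of_le_dist (by simpa using (not_le.1 hx).le)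
  have hout : ∀ γ : Euc n → ℝ, ∀ z ∉ φ.source, ((chartLift φ γ z : ℝ) : 𝕜) * u z = 0 :=
    fun γ z hz => by rw [chartLift, indicator_of_notMem hz]; simp
  have hint : ∀ γ : Euc n → ℝ, Continuous γ → (∀ x, |γ x| ≤ 1) →
      Integrable (fun z => ((chartLift φ γ z : ℝ) : 𝕜) * u z) μ := fun γ hγ hγ1 => by
    refine hu.bdd_mul (c := 1) (RCLike.continuous_ofReal.comp_aestronglyMeasurable
      (aestronglyMeasurable_chartLift hγ)) (Filter.Eventually.of_forall fun z => ?_)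
    rw [RCLike.norm_ofReal]
    by_cases hz : z ∈ φ.source
    · rw [chartLift, indicator_of_mem hz]; exact hγ1 _
    · rw [chartLift, indicator_of_notMem hz]; simp
  have hβ1 : ∀ x, |β x| ≤ 1 := fun x => by rw [abs_of_nonneg β.nonneg]; exact β.le_one
  set g : Euc n → 𝕜 := φ.target.indicator fun x =>
    (ρ x : 𝕜) * (((chartLift φ β (φ.symm x) : ℝ) : 𝕜) * u (φ.symm x)) with hg
  have hgi : Integrable g := (chart_integral hρc.continuousOn hρ0 hρ
    (hint β β.continuous hβ1) (hout β)).1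
  obtain ⟨w, hw, hgw⟩ := exists_contDiff_ae_eq_rclike hgi (k := k) (C := C) fun ξ hξ θ => by
    rw [finrank_euclideanSpace_fin]
    have hξ0 : ‖ξ‖ ≠ 0 := (one_pos.trans_le hξ).ne'
    -- Polar decomposition of the frequency: direction on the sphere, `l = ‖ξ‖`.
    have hb := hC (‖ξ‖⁻¹ • ξ) (by simp [norm_smul, hξ0]) (by simp [norm_smul, hξ0]) ‖ξ‖ θ hξ
    have hcos : ∀ x, ‖ξ‖ * inner ℝ (‖ξ‖⁻¹ • ξ) x = inner ℝ ξ x := fun x => by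
      rw [real_inner_smul_left, mul_inv_cancel_left₀ hξ0]
    simp only [hcos] at hb
    have hlift : ∀ z, chartLift φ β z * Real.cos (inner ℝ ξ (φ z) + θ) =
        chartLift φ (fun x => β x * Real.cos (inner ℝ ξ x + θ)) z := fun z => by
      by_cases hz : z ∈ φ.source
      · simp only [chartLift, indicator_of_mem hz]
      · simp only [chartLift, indicator_of_notMem hz, zero_mul]
    simp only [hlift] at hb
    rw [(chart_integral hρc.continuousOn hρ0 hρ (hint (fun x => β x * Real.cos (inner ℝ ξ x + θ))
      (β.continuous.mul (by fun_prop)) fun x => ?_) (hout _)).2] at hb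
    · refine le_trans (le_of_eq ?_) hb
      congr 2 with x
      by_cases hx : x ∈ φ.target
      · simp only [hg, indicator_of_mem hx, chartLift, indicator_of_mem (φ.map_target hx),
          φ.right_inv hx]
        push_cast
        ring
      · simp only [hg, indicator_of_notMem hx, mul_zero]
    · rw [abs_mul]
      exact mul_le_one₀ (hβ1 x) (abs_nonneg _) (Real.abs_cos_le_one _)
  -- `w` is a version of `ρ β u`; where `β = 1`, division by the smooth density recovers `u`.
  refine ⟨fun z => (ρ (φ z) : 𝕜)⁻¹ * w (φ z), ?_, ?_⟩
  · have h1 : ContDiffOn ℝ k (fun x => (ρ x : 𝕜)⁻¹ * w x) φ.target := by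
      have h2 : ContDiffOn ℝ k (fun x => (ρ x : 𝕜)) φ.target :=
        (RCLike.ofRealCLM (K := 𝕜)).contDiff.comp_contDiffOn
          (hρc.of_le (by exact_mod_cast le_top))
      exact (h2.inv fun x hx => by exact_mod_cast (hρ0 x hx).ne').mul hw.contDiffOn
    have h3 : ContMDiffOn 𝓘(ℝ, Euc n) 𝓘(ℝ, Euc n) k φ φ.source :=
      (contMDiffOn_chart (n := ∞)).of_le (by exact_mod_cast le_top)
    exact (h1.contMDiffOn.comp h3 fun z hz => φ.map_source hz).mono inter_subset_left
  · have h1 : ∀ᵐ x ∂(μ.restrict φ.source).map φ, x ∈ φ.target → g x = w x := by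
      rw [hρ]
      exact (withDensity_absolutelyContinuous _ _).ae_le
        (ae_restrict_of_ae (hgw.mono fun x hx _ => hx))
    have h2 := (ae_restrict_iff' φ.open_source.measurableSet).1
      (ae_of_ae_map (φ.continuousOn.aemeasurable φ.open_source.measurableSet) h1)
    filter_upwards [h2] with z hz hzb
    have h3 := hz hzb.1 (φ.map_source hzb.1)
    have h4 : (ρ (φ z) : 𝕜) ≠ 0 := by exact_mod_cast (hρ0 _ (φ.map_source hzb.1)).ne'
    have h5 : β (φ z) = 1 := β.one_of_mem_closedBall (Metric.ball_subset_closedBall hzb.2)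
    rw [← h3, hg, indicator_of_mem (φ.map_source hzb.1), φ.left_inv hzb.1, chartLift,
      indicator_of_mem hzb.1, h5, RCLike.ofReal_one, one_mul, inv_mul_cancel_left₀ h4]

/-- Local almost everywhere versions of class `C^k` for all `k` glue to a smooth version. -/
theorem exists_contMDiff_ae_eq [SecondCountableTopology M] [μ.IsOpenPosMeasure]
    (h : ∀ (z : M) (k : ℕ), ∃ O : Set M, IsOpen O ∧ z ∈ O ∧ ∃ v : M → 𝕜,
      ContMDiffOn 𝓘(ℝ, Euc n) 𝓘(ℝ, 𝕜) k v O ∧ ∀ᵐ x ∂μ, x ∈ O → u x = v x) :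
    ∃ v : M → 𝕜, ContMDiff 𝓘(ℝ, Euc n) 𝓘(ℝ, 𝕜) ∞ v ∧ u =ᵐ[μ] v := by
  choose O hO hzO v hv huv using h
  -- Nonempty open sets have positive measure, so continuous versions of `u` coincide on overlaps;
  -- the function built from `k = 0` is therefore `C^k` on every `O z k`.
  have key : ∀ z k, EqOn (fun x => v x 0 x) (v z k) (O z k) := fun z k x hx => by
    have hopen : IsOpen (O x 0 ∩ O z k) := (hO x 0).inter (hO z k)
    have hae : v x 0 =ᵐ[μ.restrict (O x 0 ∩ O z k)] v z k := by
      refine (ae_restrict_iff' hopen.measurableSet).2 ?_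
      filter_upwards [huv x 0, huv z k] with y h1 h2 hy
      rw [← h1 hy.1, ← h2 hy.2]
    exact Measure.eqOn_open_of_ae_eq hae hopen ((hv x 0).continuousOn.mono inter_subset_left)
      ((hv z k).continuousOn.mono inter_subset_right) ⟨hzO x 0, hx⟩
  refine ⟨fun x => v x 0 x, contMDiff_infty.2 fun k z => ?_, ?_⟩
  · exact (((hv z k).congr (key z k)) z (hzO z k)).contMDiffAt ((hO z k).mem_nhds (hzO z k))
  · refine measure_null_of_locally_null _ fun z _ =>
      ⟨_, Filter.inter_mem (mem_nhdsWithin_of_mem_nhds ((hO z 0).mem_nhds (hzO z 0)))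
        self_mem_nhdsWithin, ?_⟩
    refine measure_mono_null (fun x hx => ?_) (huv z 0)
    exact fun h => hx.2 ((h hx.1).trans (key z 0 hx.1).symm)

end Globalization

end LeafRegularity

theorem mainTheorem6 {𝕜 : Type*} [RCLike 𝕜] {n : ℕ} {M : Type*}
    [TopologicalSpace M] [T2Space M] [SecondCountableTopology M]
    [ChartedSpace (Euc n) M] [IsManifold 𝓘(ℝ, Euc n) ∞ M]
    [MeasurableSpace M] [BorelSpace M]
    (μ : Measure M) (hμ : LeafRegularity.IsSmoothVolume (n := n) μ)
    {r : ℕ} (F : Fin r → LeafRegularity.HolderFoliation n M)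
    (hac : ∀ i, (F i).StronglyAbsolutelyContinuous μ)
    (hspan : ∀ z : M, ⨆ i, (F i).tangentSpace z = ⊤)
    (u : M → 𝕜) (hu : Integrable u μ)
    (hD : ∀ i, (F i).DerivsDualToHolder (fun h : M → ℝ => ∫ z, (h z : 𝕜) * u z ∂μ)) :
    ∃ v : M → 𝕜, ContMDiff 𝓘(ℝ, Euc n) 𝓘(ℝ, 𝕜) ∞ v ∧ u =ᵐ[μ] v := by
  have := hμ.isOpenPosMeasure
  refine LeafRegularity.exists_contMDiff_ae_eq fun z k => ?_
  -- Order of decay: `k` for the derivatives, `n + 1` for integrability, `1` for the factor `l` lost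
  -- to the Hölder norm.
  obtain ⟨ε, hε, hε0⟩ := ((LeafRegularity.eventually_decaysOn_sphere hu F z (hspan z) hD
    (k + (n + 1) + 1)).and self_mem_nhdsWithin).exists
  have hε0' : 0 < ε := hε0
  obtain ⟨v, hv, huv⟩ := hε.exists_contMDiffOn hμ hu hε0'
  exact ⟨_, LeafRegularity.isOpen_chartBall _ _ _,
    LeafRegularity.mem_chartBall_self (mem_chart_source _ z) (by positivity), v, hv, huv⟩
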